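/- Let $c>\pi^2$, let $x_0\in(0,1)$, and consider the pointwise controlled heat equation $$y_t-y_{xx}-cy=\delta(x-x_0)u(t)\ \text{ in }\mathbb{R}^+\times(0,1),\qquad y(t,0)=y(t,1)=0,\qquad y(0,\cdot)=y_0\in L^2(0,1),$$ that is, the system $y'=Ay+Bu$ with state space $X=L^2(0,1)$ (real-valued), control space $U=\mathbb{R}$, $Ay=y''+cy$ with $D(A)=H^2(0,1)\cap H^1_0(0,1)$, and $B\in\mathcal{L}(U;X_{-1})$, $Bu=\delta(\cdot-x_0)u$, where $X_{-1}$ is the dual of $D(A^*)$ (with the graph norm) with respect to the pivot space $X$. The system is called completely stabilizable if for every $\alpha>0$ there is a linear operator $K$ from a subspace $D(K)\supseteq D(A)$ of $X$ to $U$, with $K|_{D(A)}\in\mathcal{L}(D(A);U)$, such that (a) the operator $A_K:=A+BK$ (the sum being taken in $X_{-1}$, with $A$ extended to $X\to X_{-1}$), with domain $D(A_K):=\{x\in D(K): A_Kx\in X\}$, generates a $C_0$-semigroup $S_K(t)$, $t\ge 0$, on $X$; (b) there is $C>0$ such that $\|S_K(t)\|_{\mathcal{L}(X)}\le Ce^{-\alpha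 t}$ for all $t\ge 0$; (c) $K\in\mathcal{L}(D(A_K);U)$, where $D(A_K)$ carries the graph norm; (d) there is $D>0$ such that for each $y_0\in D(A_K)$ the control $u(t):=KS_K(t)y_0$ satisfies $\|u\|_{L^2(\mathbb{R}^+;U)}\le D\|y_0\|_X$. Then the system is completely stabilizable if and only if $x_0$ is irrational. -/

import Mathlib

open MeasureTheory Set Filter Topology
open scoped ContDiff

noncomputable section

/-! ### Stabilization of linear control systems with an unbounded control operator -/

section Abstract

variable {X U : Type*} [NormedAddCommGroup X] [InnerProductSpace ℝ X] [CompleteSpace X]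
  [NormedAddCommGroup U] [InnerProductSpace ℝ U]

/-- `S(t)`, `t ≥ 0`, is a `C₀`-semigroup of bounded operators on `X`. Values at negative times are
irrelevant. -/
structure IsC0Semigroup (S : ℝ → X →L[ℝ] X) : Prop where
  map_zero : S 0 = ContinuousLinearMap.id ℝ X
  map_add : ∀ s t : ℝ, 0 ≤ s → 0 ≤ t → S (s + t) = (S s).comp (S t)
  tendsto_zero : ∀ x : X, Tendsto (fun t : ℝ => S t x) (𝓝[>] 0) (𝓝 x)

/-- The operator with graph `{(x, z) | G x z}` is the infinitesimal generator of `S`: `x` is in the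
domain with image `z` exactly when `(S(t) x - x) / t → z` as `t ↓ 0`. -/
def IsGeneratorOf (G : X → X → Prop) (S : ℝ → X →L[ℝ] X) : Prop :=
  ∀ x z : X, G x z ↔ Tendsto (fun t : ℝ => t⁻¹ • (S t x - x)) (𝓝[>] 0) (𝓝 z)

/-- The extrapolation space `X₋₁`: the dual of `D(A*)` (with respect to the pivot space `X`). Here
`D(A*)` carries the graph norm, being identified with the graph of `A*` in `X × X`. -/
abbrev ExtrapolationSpace (A : X →ₗ.[ℝ] X) : Type _ := StrongDual ℝ A.adjoint.graph

/-- `IsClosedLoop A B K x z` says `x ∈ D(A_K)` and `A_K x = z`, where `A_K = A + B K` and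
`D(A_K) = {x : A_K x ∈ X}`. The sum is taken in `X₋₁`: the extension of `A` to `X` sends `x` to
`φ ↦ ⟪x, A* φ⟫`, and an element `z` of `X` is the functional `φ ↦ ⟪z, φ⟫`. The feedback operator
`K` may be unbounded, so `A_K x` makes sense only for `x` in the domain of `K`. -/
def IsClosedLoop (A : X →ₗ.[ℝ] X) (B : U →L[ℝ] ExtrapolationSpace A) (K : X →ₗ.[ℝ] U)
    (x z : X) : Prop :=
  ∃ hx : x ∈ K.domain, ∀ φ : A.adjoint.graph,
    inner ℝ x (φ : X × X).2 + B (K ⟨x, hx⟩) φ = inner ℝ z (φ : X × X).1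

/-- `K` is a feedback law for `y' = A y + B u` that stabilizes the system at rate `α`, and `S` is
the closed-loop semigroup. -/
structure IsStabilizingFeedback (A : X →ₗ.[ℝ] X) (B : U →L[ℝ] ExtrapolationSpace A)
    (α : ℝ) (K : X →ₗ.[ℝ] U) (S : ℝ → X →L[ℝ] X) : Prop where
  /-- `K` is defined on `D(A)`. -/
  domain_le : A.domain ≤ K.domain
  /-- `K ∈ 𝓛(D(A); U)`. -/
  bounded_domain : ∃ M : ℝ, ∀ (x : A.domain) (hx : (x : X) ∈ K.domain),
    ‖K ⟨x, hx⟩‖ ≤ M * (‖(x : X)‖ + ‖A x‖)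
  /-- `S` is a `C₀`-semigroup. -/
  semigroup : IsC0Semigroup S
  /-- `A_K` generates `S`. -/
  generator : IsGeneratorOf (IsClosedLoop A B K) S
  /-- `S` decays at rate `α`. -/
  decay : ∃ C : ℝ, 0 < C ∧ ∀ t : ℝ, 0 ≤ t → ‖S t‖ ≤ C * Real.exp (-α * t)
  /-- `K ∈ 𝓛(D(A_K); U)`. -/
  bounded_closedLoop : ∃ M : ℝ, ∀ (x z : X) (hx : x ∈ K.domain), IsClosedLoop A B K x z →
    ‖K ⟨x, hx⟩‖ ≤ M * (‖x‖ + ‖z‖)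
  /-- For `y₀ ∈ D(A_K)` the control `u(t) = K S(t) y₀` is in `L²(ℝ⁺; U)` with norm at most
  `D ‖y₀‖`. -/
  control_bound : ∃ D : ℝ, 0 < D ∧ ∀ y₀ z₀ : X, IsClosedLoop A B K y₀ z₀ →
    ∃ u : ℝ → U, (∀ t : ℝ, 0 ≤ t → (S t y₀, u t) ∈ K.graph) ∧
      MemLp u 2 (volume.restrict (Ioi 0)) ∧
      eLpNorm u 2 (volume.restrict (Ioi 0)) ≤ ENNReal.ofReal (D * ‖y₀‖)

/-- The system `y' = A y + B u` is completely stabilizable: every decay rate `α > 0` is achieved by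
some feedback law. -/
def CompletelyStabilizable (A : X →ₗ.[ℝ] X) (B : U →L[ℝ] ExtrapolationSpace A) : Prop :=
  ∀ α : ℝ, 0 < α → ∃ (K : X →ₗ.[ℝ] U) (S : ℝ → X →L[ℝ] X), IsStabilizingFeedback A B α K S

end Abstract

/-! ### The operator `A y = y'' + c y` with Dirichlet boundary conditions on `(0, 1)` -/

namespace PointHeat

/-- Lebesgue measure on `(0, 1)`. -/
abbrev μ : Measure ℝ := volume.restrict (Ioo (0 : ℝ) 1)

/-- The state space `L²(0, 1)`. -/
abbrev State : Type := Lp ℝ 2 μ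

/-- Test functions on `(0, 1)`, the elements of `C_c^∞(0, 1)`. -/
structure IsTest (ψ : ℝ → ℝ) : Prop where
  smooth : ContDiff ℝ ∞ ψ
  compact : HasCompactSupport ψ
  supp : tsupport ψ ⊆ Ioo 0 1

/-- `g ∈ L²(0, 1)` is the weak derivative of `f ∈ L²(0, 1)`. -/
def HasWeakDeriv (f g : State) : Prop :=
  ∀ ψ : ℝ → ℝ, IsTest ψ → ∫ x, f x * deriv ψ x ∂μ = -∫ x, g x * ψ x ∂μ

/-- `v` is a representative of `f ∈ L²(0, 1)` that is continuous on `[0, 1]`. -/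
def IsContRep (f : State) (v : ℝ → ℝ) : Prop :=
  ContinuousOn v (Icc 0 1) ∧ f =ᵐ[μ] v

/-- The Dirichlet condition `f(0) = f(1) = 0`, for the continuous representative of `f`. -/
def VanishesAtEnds (f : State) : Prop :=
  ∃ v : ℝ → ℝ, IsContRep f v ∧ v 0 = 0 ∧ v 1 = 0

theorem memLp_of_continuousOn {ψ : ℝ → ℝ} (h : ContinuousOn ψ (Icc 0 1)) : MemLp ψ 2 μ := by
  obtain ⟨C, hC⟩ := isCompact_Icc.exists_bound_of_continuousOn h
  refine MemLp.of_bound ((h.mono Ioo_subset_Icc_self).aestronglyMeasurable measurableSet_Ioo) C ?_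
  filter_upwards [ae_restrict_mem measurableSet_Ioo] with x hx
  exact hC x (Ioo_subset_Icc_self hx)

theorem integrable_mul (f : State) {ψ : ℝ → ℝ} (h : ContinuousOn ψ (Icc 0 1)) :
    Integrable (fun x => f x * ψ x) μ :=
  (Lp.memLp f).integrable_mul (memLp_of_continuousOn h)

theorem IsTest.continuous_deriv {ψ : ℝ → ℝ} (h : IsTest ψ) : Continuous (deriv ψ) :=
  h.smooth.continuous_deriv (by simp)

theorem HasWeakDeriv.add {f₁ g₁ f₂ g₂ : State} (h₁ : HasWeakDeriv f₁ g₁)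
    (h₂ : HasWeakDeriv f₂ g₂) : HasWeakDeriv (f₁ + f₂) (g₁ + g₂) := by
  intro ψ hψ
  have e₁ : ∫ x, (f₁ + f₂ : State) x * deriv ψ x ∂μ
      = ∫ x, (f₁ x * deriv ψ x + f₂ x * deriv ψ x) ∂μ := by
    refine integral_congr_ae ?_
    filter_upwards [Lp.coeFn_add f₁ f₂] with x hx
    rw [hx, Pi.add_apply, add_mul]
  have e₂ : ∫ x, (g₁ + g₂ : State) x * ψ x ∂μ = ∫ x, (g₁ x * ψ x + g₂ x * ψ x) ∂μ := by
    refine integral_congr_ae ?_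
    filter_upwards [Lp.coeFn_add g₁ g₂] with x hx
    rw [hx, Pi.add_apply, add_mul]
  have c₁ := hψ.continuous_deriv.continuousOn (s := Icc 0 1)
  have c₂ := hψ.smooth.continuous.continuousOn (s := Icc 0 1)
  rw [e₁, e₂, integral_add (integrable_mul f₁ c₁) (integrable_mul f₂ c₁),
    integral_add (integrable_mul g₁ c₂) (integrable_mul g₂ c₂), h₁ ψ hψ, h₂ ψ hψ]
  ring

theorem HasWeakDeriv.smul {f g : State} (a : ℝ) (h : HasWeakDeriv f g) :
    HasWeakDeriv (a • f) (a • g) := by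
  intro ψ hψ
  have e₁ : ∫ x, (a • f : State) x * deriv ψ x ∂μ = ∫ x, a * (f x * deriv ψ x) ∂μ := by
    refine integral_congr_ae ?_
    filter_upwards [Lp.coeFn_smul a f] with x hx
    simp [hx, mul_assoc]
  have e₂ : ∫ x, (a • g : State) x * ψ x ∂μ = ∫ x, a * (g x * ψ x) ∂μ := by
    refine integral_congr_ae ?_
    filter_upwards [Lp.coeFn_smul a g] with x hx
    simp [hx, mul_assoc]
  rw [e₁, e₂, integral_const_mul, integral_const_mul, h ψ hψ]
  ring

theorem IsContRep.add {f₁ f₂ : State} {v₁ v₂ : ℝ → ℝ} (h₁ : IsContRep f₁ v₁)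
    (h₂ : IsContRep f₂ v₂) : IsContRep (f₁ + f₂) (fun x => v₁ x + v₂ x) := by
  refine ⟨h₁.1.add h₂.1, ?_⟩
  filter_upwards [Lp.coeFn_add f₁ f₂, h₁.2, h₂.2] with x hx h1 h2
  rw [hx, Pi.add_apply, h1, h2]

theorem IsContRep.smul {f : State} {v : ℝ → ℝ} (a : ℝ) (h : IsContRep f v) :
    IsContRep (a • f) (fun x => a * v x) := by
  refine ⟨continuousOn_const.mul h.1, ?_⟩
  filter_upwards [Lp.coeFn_smul a f, h.2] with x hx h1
  simp [hx, h1]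

theorem IsContRep.eqOn {f : State} {v w : ℝ → ℝ} (hv : IsContRep f v) (hw : IsContRep f w) :
    EqOn v w (Icc 0 1) := by
  have h : v =ᵐ[volume.restrict (Icc (0 : ℝ) 1)] w := by
    rw [← restrict_Ioo_eq_restrict_Icc]
    exact hv.2.symm.trans hw.2
  exact Measure.eqOn_Icc_of_ae_eq volume zero_ne_one h hv.1 hw.1

theorem isContRep_zero : IsContRep 0 (fun _ => 0) :=
  ⟨continuousOn_const, Lp.coeFn_zero ℝ 2 μ⟩

theorem hasWeakDeriv_zero : HasWeakDeriv 0 0 := by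
  intro ψ _
  have h : ∀ θ : ℝ → ℝ, ∫ x, (0 : State) x * θ x ∂μ = 0 := by
    intro θ
    refine integral_eq_zero_of_ae ?_
    filter_upwards [Lp.coeFn_zero ℝ 2 μ] with x hx
    rw [hx, Pi.zero_apply, zero_mul]
  rw [h, h, neg_zero]

/-- The graph of `A y = y'' + c y` with domain `H²(0, 1) ∩ H₀¹(0, 1)`, that is, the `y` with weak
derivatives `y'` and `y''` in `L²(0, 1)` and `y(0) = y(1) = 0`. -/
def heatGraph (c : ℝ) : Submodule ℝ (State × State) where
  carrier := {p | VanishesAtEnds p.1 ∧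
    ∃ g h : State, HasWeakDeriv p.1 g ∧ HasWeakDeriv g h ∧ p.2 = h + c • p.1}
  zero_mem' := ⟨⟨_, isContRep_zero, rfl, rfl⟩, 0, 0, hasWeakDeriv_zero, hasWeakDeriv_zero, by simp⟩
  add_mem' := by
    rintro p q ⟨⟨v, hv, hv0, hv1⟩, g, h, hg, hh, e⟩ ⟨⟨w, hw, hw0, hw1⟩, g', h', hg', hh', e'⟩
    refine ⟨⟨_, hv.add hw, by simp [hv0, hw0], by simp [hv1, hw1]⟩, g + g', h + h',
      hg.add hg', hh.add hh', ?_⟩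
    simp only [Prod.snd_add, Prod.fst_add, e, e', smul_add]
    abel
  smul_mem' := by
    rintro a p ⟨⟨v, hv, hv0, hv1⟩, g, h, hg, hh, e⟩
    refine ⟨⟨_, hv.smul a, by simp [hv0], by simp [hv1]⟩, a • g, a • h, hg.smul a, hh.smul a, ?_⟩
    simp only [Prod.smul_snd, Prod.smul_fst, e, smul_add, smul_comm a c]

/-- The operator `A y = y'' + c y` in `L²(0, 1)`, with domain `H²(0, 1) ∩ H₀¹(0, 1)`. -/
def heatOp (c : ℝ) : State →ₗ.[ℝ] State := (heatGraph c).toLinearPMap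

theorem eq_zero_of_test {f : State} (h : ∀ ψ : ℝ → ℝ, IsTest ψ → ∫ x, f x * ψ x ∂μ = 0) :
    f = 0 := by
  have hf : IntegrableOn (fun x => f x) (Ioo 0 1) volume := by
    have := integrable_mul f (ψ := fun _ => 1) continuousOn_const
    simp only [mul_one] at this
    exact this
  have key := isOpen_Ioo.ae_eq_zero_of_integral_contDiff_smul_eq_zero (μ := volume)
    hf.locallyIntegrableOn (fun ψ h1 h2 h3 => by
      rw [← h ψ ⟨h1, h2, h3⟩, ← setIntegral_eq_integral_of_forall_compl_eq_zero (s := Ioo 0 1)]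
      · simp [mul_comm]
      · intro x hx
        rw [image_eq_zero_of_notMem_tsupport (fun hx' => hx (h3 hx')), zero_smul])
  rw [Lp.eq_zero_iff_ae_eq_zero]
  exact (ae_restrict_iff' measurableSet_Ioo).2 key

theorem HasWeakDeriv.eq_zero {h : State} (H : HasWeakDeriv 0 h) : h = 0 := by
  refine eq_zero_of_test fun ψ hψ => ?_
  have e : ∫ x, (0 : State) x * deriv ψ x ∂μ = 0 := by
    refine integral_eq_zero_of_ae ?_
    filter_upwards [Lp.coeFn_zero ℝ 2 μ] with x hx
    rw [hx, Pi.zero_apply, zero_mul]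
  have := H ψ hψ
  rw [e] at this
  linarith

/-- Weak second derivatives are unique, so `heatGraph c` is the graph of `heatOp c`. -/
theorem heatOp_graph (c : ℝ) : (heatOp c).graph = heatGraph c := by
  refine Submodule.toLinearPMap_graph_eq _ ?_
  rintro ⟨x, z⟩ ⟨-, g, h, hg, hh, e⟩ hx
  simp only at hx hg e
  subst hx
  obtain rfl := hg.eq_zero
  obtain rfl := hh.eq_zero
  simpa using e

/-- The class in `L²(0, 1)` of a function continuous on `[0, 1]`. -/
def mk (v : ℝ → ℝ) (h : ContinuousOn v (Icc 0 1)) : State := (memLp_of_continuousOn h).toLp v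

theorem isContRep_mk {v : ℝ → ℝ} (h : ContinuousOn v (Icc 0 1)) : IsContRep (mk v h) v :=
  ⟨h, MemLp.coeFn_toLp _⟩

theorem integral_mk_mul {v : ℝ → ℝ} (h : ContinuousOn v (Icc 0 1)) (θ : ℝ → ℝ) :
    ∫ x, mk v h x * θ x ∂μ = ∫ x in (0 : ℝ)..1, v x * θ x := by
  rw [intervalIntegral.integral_of_le zero_le_one, integral_Ioc_eq_integral_Ioo]
  refine integral_congr_ae ?_
  filter_upwards [(isContRep_mk h).2] with x hx
  rw [hx]

theorem hasWeakDeriv_mk {v w : ℝ → ℝ} (hv : ContinuousOn v (Icc 0 1))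
    (hw : ContinuousOn w (Icc 0 1)) (h : ∀ x, HasDerivAt v (w x) x) :
    HasWeakDeriv (mk v hv) (mk w hw) := by
  intro ψ hψ
  rw [integral_mk_mul, integral_mk_mul]
  have h0 : ψ 0 = 0 := image_eq_zero_of_notMem_tsupport fun h => by simpa using hψ.supp h
  have h1 : ψ 1 = 0 := image_eq_zero_of_notMem_tsupport fun h => by simpa using hψ.supp h
  rw [intervalIntegral.integral_mul_deriv_eq_deriv_mul (u := v) (v := ψ) (u' := w)
    (v' := deriv ψ) (fun x _ => h x)
    (fun x _ => (hψ.smooth.differentiable (by simp) x).hasDerivAt)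
    (ContinuousOn.intervalIntegrable (by simpa using hw))
    (hψ.continuous_deriv.intervalIntegrable _ _), h0, h1]
  simp

/-- Classical `C²` functions vanishing at both ends are in the domain of `heatOp c`. -/
theorem mem_heatOp_graph {y y' f : ℝ → ℝ} (hy : ContinuousOn y (Icc 0 1))
    (hy' : ContinuousOn y' (Icc 0 1)) (hf : ContinuousOn f (Icc 0 1))
    (h₁ : ∀ x, HasDerivAt y (y' x) x) (h₂ : ∀ x, HasDerivAt y' (f x) x)
    (h0 : y 0 = 0) (h1 : y 1 = 0) (c : ℝ) :
    (mk y hy, mk f hf + c • mk y hy) ∈ (heatOp c).graph := by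
  rw [heatOp_graph]
  exact ⟨⟨y, isContRep_mk hy, h0, h1⟩, mk y' hy', mk f hf, hasWeakDeriv_mk hy hy' h₁,
    hasWeakDeriv_mk hy' hf h₂, rfl⟩

theorem inner_mk (f : State) {v : ℝ → ℝ} (hv : ContinuousOn v (Icc 0 1)) :
    inner ℝ f (mk v hv) = ∫ x, f x * v x ∂μ := by
  rw [L2.inner_def]
  refine integral_congr_ae ?_
  filter_upwards [(isContRep_mk hv).2] with x hx
  rw [hx]
  simp [mul_comm]

theorem dense_heatOp_domain (c : ℝ) : Dense ((heatOp c).domain : Set State) := by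
  rw [Submodule.dense_iff_topologicalClosure_eq_top, Submodule.topologicalClosure_eq_top_iff,
    Submodule.eq_bot_iff]
  intro f hf
  refine eq_zero_of_test fun ψ hψ => ?_
  have d1 : ContDiff ℝ ∞ (deriv ψ) := hψ.smooth.deriv'
  have hm := mem_heatOp_graph (hψ.smooth.continuous.continuousOn (s := Icc 0 1))
    (d1.continuous.continuousOn (s := Icc 0 1))
    ((d1.continuous_deriv (by simp)).continuousOn (s := Icc 0 1))
    (fun x => (hψ.smooth.differentiable (by simp) x).hasDerivAt)
    (fun x => (d1.differentiable (by simp) x).hasDerivAt)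
    (image_eq_zero_of_notMem_tsupport fun h => by simpa using hψ.supp h)
    (image_eq_zero_of_notMem_tsupport fun h => by simpa using hψ.supp h) c
  rw [← inner_mk f hψ.smooth.continuous.continuousOn]
  exact Submodule.inner_left_of_mem_orthogonal (LinearPMap.mem_domain_of_mem_graph hm) hf

/-- The Green function of `y'' = f`, `y(0) = y(1) = 0`. -/
def green (x s : ℝ) : ℝ := -(min x s * (1 - max x s))

theorem continuous_green : Continuous fun p : ℝ × ℝ => green p.1 p.2 := by
  unfold green
  fun_prop

theorem abs_green_le {x s : ℝ} (hx : x ∈ Icc (0 : ℝ) 1) (hs : s ∈ Icc (0 : ℝ) 1) :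
    |green x s| ≤ 1 := by
  have h1 : 0 ≤ min x s := le_min hx.1 hs.1
  have h2 : min x s ≤ 1 := (min_le_left _ _).trans hx.2
  have h3 : 0 ≤ max x s := hx.1.trans (le_max_left _ _)
  have h4 : max x s ≤ 1 := max_le hx.2 hs.2
  unfold green
  rw [abs_neg, abs_of_nonneg (mul_nonneg h1 (by linarith))]
  nlinarith

/-- The solution operator of the Dirichlet problem. -/
def greenOp (h : ℝ → ℝ) (x : ℝ) : ℝ := ∫ s, green x s * h s ∂μ

theorem greenOp_continuousOn (h : State) : ContinuousOn (greenOp h) (Icc 0 1) := by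
  have hi : Integrable (fun x => h x) μ := by
    simpa using integrable_mul h (ψ := fun _ => 1) continuousOn_const
  refine continuousOn_of_dominated (bound := fun s => |h s|) (fun x _ => ?_) (fun x hx => ?_)
    hi.abs (Eventually.of_forall fun s => ?_)
  · exact ((continuous_green.comp (by fun_prop : Continuous fun s : ℝ => (x, s))
      ).aestronglyMeasurable).mul hi.aestronglyMeasurable
  · filter_upwards [ae_restrict_mem measurableSet_Ioo] with s hs
    rw [norm_mul]
    exact mul_le_of_le_one_left (norm_nonneg _) (abs_green_le hx (Ioo_subset_Icc_self hs))
  · exact ((continuous_green.comp (by fun_prop : Continuous fun x : ℝ => (x, s))).mul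
      continuous_const).continuousOn

theorem abs_greenOp_le (h : State) {x : ℝ} (hx : x ∈ Icc (0 : ℝ) 1) : |greenOp h x| ≤ ‖h‖ := by
  have hc : ContinuousOn (green x) (Icc 0 1) :=
    (continuous_green.comp (by fun_prop : Continuous fun s : ℝ => (x, s))).continuousOn
  have e : greenOp h x = inner ℝ h (mk (green x) hc) := by
    rw [inner_mk]
    simp [greenOp, mul_comm]
  rw [e]
  refine (abs_real_inner_le_norm _ _).trans (mul_le_of_le_one_right (norm_nonneg _) ?_)
  have := Lp.norm_le_of_ae_bound (f := mk (green x) hc) (C := 1) zero_le_one (by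
    filter_upwards [(isContRep_mk hc).2, ae_restrict_mem measurableSet_Ioo] with s hs hs'
    rw [hs]
    exact abs_green_le hx (Ioo_subset_Icc_self hs'))
  simpa [measureUnivNNReal] using this

theorem exists_solution {f : ℝ → ℝ} (hf : Continuous f) :
    ∃ y y' : ℝ → ℝ, (∀ x, HasDerivAt y (y' x) x) ∧ (∀ x, HasDerivAt y' (f x) x) ∧
      y 0 = 0 ∧ y 1 = 0 ∧ EqOn y (greenOp f) (Icc 0 1) := by
  have cP : Continuous fun s : ℝ => s * f s := by fun_prop
  have cQ : Continuous fun s : ℝ => (1 - s) * f s := by fun_prop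
  set P : ℝ → ℝ := fun x => ∫ s in (0 : ℝ)..x, s * f s with hP
  set Q : ℝ → ℝ := fun x => ∫ s in x..(1 : ℝ), (1 - s) * f s with hQ
  have dP : ∀ x, HasDerivAt P (x * f x) x := fun x => cP.integral_hasStrictDerivAt 0 x |>.hasDerivAt
  have dQ : ∀ x, HasDerivAt Q (-((1 - x) * f x)) x := fun x =>
    intervalIntegral.integral_hasDerivAt_left (cQ.intervalIntegrable _ _)
      (cQ.stronglyMeasurableAtFilter _ _) cQ.continuousAt
  refine ⟨fun x => -((1 - x) * P x) - x * Q x, fun x => P x - Q x, fun x => ?_, fun x => ?_,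
    by simp [hP], by simp [hQ], fun x hx => ?_⟩
  · refine (((((hasDerivAt_id x).const_sub 1).mul (dP x)).neg).sub
      ((hasDerivAt_id x).mul (dQ x))).congr_deriv ?_
    simp only [id]
    ring
  · refine ((dP x).sub (dQ x)).congr_deriv ?_
    ring
  · have cG : Continuous fun s : ℝ => green x s * f s :=
      (continuous_green.comp (by fun_prop : Continuous fun s : ℝ => (x, s))).mul hf
    have e : greenOp f x = ∫ s in (0 : ℝ)..1, green x s * f s := by
      rw [intervalIntegral.integral_of_le zero_le_one, integral_Ioc_eq_integral_Ioo]
      rfl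
    rw [e, ← intervalIntegral.integral_add_adjacent_intervals (cG.intervalIntegrable 0 x)
      (cG.intervalIntegrable x 1)]
    have e1 : ∫ s in (0 : ℝ)..x, green x s * f s = ∫ s in (0 : ℝ)..x, -(1 - x) * (s * f s) := by
      refine intervalIntegral.integral_congr fun s hs => ?_
      rw [uIcc_of_le hx.1] at hs
      simp only [green, min_eq_right hs.2, max_eq_left hs.2]
      ring
    have e2 : ∫ s in x..(1 : ℝ), green x s * f s = ∫ s in x..(1 : ℝ), -x * ((1 - s) * f s) := by
      refine intervalIntegral.integral_congr fun s hs => ?_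
      rw [uIcc_of_le hx.2] at hs
      simp only [green, min_eq_left hs.1, max_eq_right hs.1]
      ring
    rw [e1, e2, intervalIntegral.integral_const_mul, intervalIntegral.integral_const_mul]
    ring

theorem green_comm (x s : ℝ) : green x s = green s x := by
  simp [green, min_comm, max_comm]

theorem integral_mul_greenOp (h : State) {f : ℝ → ℝ} (hf : Continuous f) :
    ∫ x, h x * greenOp f x ∂μ = ∫ x, greenOp h x * f x ∂μ := by
  have hi : Integrable (fun x => h x) μ := by
    simpa using integrable_mul h (ψ := fun _ => 1) continuousOn_const
  have fi : Integrable f μ := (memLp_of_continuousOn hf.continuousOn).integrable (by norm_num)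
  have hint : Integrable (Function.uncurry fun x s : ℝ => green x s * (h x * f s)) (μ.prod μ) := by
    refine (hi.mul_prod fi).bdd_mul (c := 1) continuous_green.aestronglyMeasurable ?_
    have : ∀ᵐ p : ℝ × ℝ ∂(μ.prod μ), p ∈ Ioo (0 : ℝ) 1 ×ˢ Ioo (0 : ℝ) 1 := by
      rw [Measure.prod_restrict]
      exact ae_restrict_mem (measurableSet_Ioo.prod measurableSet_Ioo)
    filter_upwards [this] with p hp
    exact abs_green_le (Ioo_subset_Icc_self hp.1) (Ioo_subset_Icc_self hp.2)
  have e1 : ∀ x, h x * greenOp f x = ∫ s, green x s * (h x * f s) ∂μ := fun x => by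
    rw [greenOp, ← integral_const_mul]
    exact integral_congr_ae (Eventually.of_forall fun s => by ring)
  have e2 : ∀ s, greenOp h s * f s = ∫ x, green x s * (h x * f s) ∂μ := fun s => by
    rw [greenOp, ← integral_mul_const]
    exact integral_congr_ae (Eventually.of_forall fun x => by
      simp only [green_comm x s]
      ring)
  simp only [e1, e2]
  exact integral_integral_swap hint

/-- Elements of `D(A*)` have a continuous representative, bounded by the graph norm. -/
theorem exists_contRep {c : ℝ} {p : State × State} (hp : p ∈ (heatOp c).adjoint.graph) :
    ∃ v : ℝ → ℝ, IsContRep p.1 v ∧ ∀ x ∈ Icc (0 : ℝ) 1, |v x| ≤ (1 + |c|) * ‖p‖ := by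
  set h : State := p.2 - c • p.1 with hh
  have hG := greenOp_continuousOn h
  have key : p.1 = mk (greenOp h) hG := by
    rw [← sub_eq_zero]
    refine eq_zero_of_test fun ψ hψ => ?_
    have hc := hψ.smooth.continuous
    obtain ⟨y, y', d1, d2, y0, y1, hy⟩ := exists_solution hc
    have cy : Continuous y := continuous_iff_continuousAt.2 fun x => (d1 x).continuousAt
    have cy' : Continuous y' := continuous_iff_continuousAt.2 fun x => (d2 x).continuousAt
    have hm := mem_heatOp_graph cy.continuousOn cy'.continuousOn hc.continuousOn d1 d2 y0 y1 c
    obtain ⟨a, ha1, ha2⟩ := (LinearPMap.mem_graph_iff _).1 hp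
    obtain ⟨b, hb1, hb2⟩ := (LinearPMap.mem_graph_iff _).1 hm
    have hadj := LinearPMap.adjoint_isFormalAdjoint (dense_heatOp_domain c) a b
    rw [ha1, ha2, hb1, hb2, inner_add_right, inner_smul_right] at hadj
    have e3 : inner ℝ p.1 (mk ψ hc.continuousOn) = inner ℝ h (mk y cy.continuousOn) := by
      rw [hh, inner_sub_left, real_inner_smul_left, hadj]
      ring
    rw [← inner_mk _ hc.continuousOn, inner_sub_left, e3, inner_mk, real_inner_comm,
      real_inner_comm, inner_mk]
    have e4 : ∫ x, h x * y x ∂μ = ∫ x, h x * greenOp ψ x ∂μ := by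
      refine integral_congr_ae ?_
      filter_upwards [ae_restrict_mem measurableSet_Ioo] with x hx
      rw [hy (Ioo_subset_Icc_self hx)]
    have e5 : ∫ x, mk (greenOp h) hG x * ψ x ∂μ = ∫ x, greenOp h x * ψ x ∂μ := by
      refine integral_congr_ae ?_
      filter_upwards [(isContRep_mk hG).2] with x hx
      rw [hx]
    rw [e4, e5, integral_mul_greenOp h hc, sub_self]
  refine ⟨greenOp h, key ▸ isContRep_mk hG, fun x hx => (abs_greenOp_le h hx).trans ?_⟩
  calc ‖h‖ ≤ ‖p.2‖ + ‖c • p.1‖ := norm_sub_le _ _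
    _ = ‖p.2‖ + |c| * ‖p.1‖ := by rw [norm_smul, Real.norm_eq_abs]
    _ ≤ ‖p‖ + |c| * ‖p‖ := by
        gcongr
        · exact norm_snd_le p
        · exact norm_fst_le p
    _ = (1 + |c|) * ‖p‖ := by ring

/-- The Dirac mass `δ(· - x₀)` as an element of `X₋₁`: it sends `φ ∈ D(A*)` to the value at `x₀` of
the continuous representative of `φ`. -/
def dirac (c : ℝ) (x₀ : Ioo (0 : ℝ) 1) : ExtrapolationSpace (heatOp c) :=
  LinearMap.mkContinuous
    { toFun := fun φ => (exists_contRep φ.2).choose x₀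
      map_add' := fun φ φ' =>
        (exists_contRep (φ + φ').2).choose_spec.1.eqOn
          ((exists_contRep φ.2).choose_spec.1.add (exists_contRep φ'.2).choose_spec.1)
          (Ioo_subset_Icc_self x₀.2)
      map_smul' := fun a φ =>
        (exists_contRep (a • φ).2).choose_spec.1.eqOn
          ((exists_contRep φ.2).choose_spec.1.smul a) (Ioo_subset_Icc_self x₀.2) }
    (1 + |c|)
    (fun φ => (exists_contRep φ.2).choose_spec.2 x₀ (Ioo_subset_Icc_self x₀.2))

/-- The control operator `B u = δ(· - x₀) u`, from `U = ℝ` to `X₋₁`. -/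
def pointControl (c : ℝ) (x₀ : Ioo (0 : ℝ) 1) : ℝ →L[ℝ] ExtrapolationSpace (heatOp c) :=
  ContinuousLinearMap.toSpanSingleton ℝ (dirac c x₀)

end PointHeat

end

/-!
The operator `A` has the orthonormal eigenbasis `√2 sin((n + 1) π x)`, and the control acts on the
`n`-th mode through `√2 sin((n + 1) π x₀)`, which is nonzero for every `n` exactly when `x₀` is
irrational.

If a mode with eigenvalue `l` is not controlled, every closed-loop generator inherits `l` as an
eigenvalue of its adjoint, and no decay rate above `-l` is possible.

If all modes are controlled, only finitely many eigenvalues `l n`, `n ∈ s`, exceed `-α`. Choose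
distinct `m j < -α`, `j ∈ s`, outside the spectrum. In coefficients, the map
`a ↦ β n * ∑ j ∈ s, a j / (l n - m j) + (if n ∈ s then 0 else a n)` is of the form identity plus
finite rank, and it is injective because Cauchy matrices are, so it is an isomorphism of `X`. It
conjugates the diagonal operator in which `m` replaces `l` on `s` to a closed loop `A + B K` with
bounded `K`.
-/

noncomputable section

open scoped InnerProductSpace

/-! ### Coefficients in a Hilbert basis -/

section HilbertBasisCoefficients

variable {ι 𝕜 H : Type*} [RCLike 𝕜] [NormedAddCommGroup H] [InnerProductSpace 𝕜 H]
  (b : HilbertBasis ι 𝕜 H)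

theorem hasSum_norm_inner_basis_sq (x : H) : HasSum (fun i => ‖⟪b i, x⟫_𝕜‖ ^ 2) (‖x‖ ^ 2) := by
  simpa [b.repr_apply_apply] using lp.hasSum_norm (p := 2) (by norm_num) (b.repr x)

theorem eq_of_inner_basis_eq {x y : H} (h : ∀ i, ⟪b i, x⟫_𝕜 = ⟪b i, y⟫_𝕜) : x = y := by
  refine b.repr.injective (lp.ext (funext fun i => ?_))
  rw [b.repr_apply_apply, b.repr_apply_apply, h]

theorem norm_le_of_norm_inner_basis_le {x y : H} {C : ℝ} (hC : 0 ≤ C)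
    (h : ∀ i, ‖⟪b i, y⟫_𝕜‖ ≤ C * ‖⟪b i, x⟫_𝕜‖) : ‖y‖ ≤ C * ‖x‖ := by
  refine le_of_sq_le_sq ?_ (by positivity)
  rw [mul_pow]
  refine hasSum_le (fun i => ?_) (hasSum_norm_inner_basis_sq b y)
    ((hasSum_norm_inner_basis_sq b x).mul_left (C ^ 2))
  rw [← mul_pow]
  exact pow_le_pow_left₀ (norm_nonneg _) (h i) 2

theorem exists_inner_basis_eq {a : ι → 𝕜} (ha : Summable fun i => ‖a i‖ ^ 2) :
    ∃ x : H, ∀ i, ⟪b i, x⟫_𝕜 = a i :=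
  ⟨b.repr.symm ⟨a, memℓp_gen (by simpa using ha)⟩, fun i => by
    rw [← b.repr_apply_apply, LinearIsometryEquiv.apply_symm_apply]⟩

theorem exists_inner_basis_eq_mul {m : ι → 𝕜} {C : ℝ} (hm : ∀ i, ‖m i‖ ≤ C) (x : H) :
    ∃ y : H, ∀ i, ⟪b i, y⟫_𝕜 = m i * ⟪b i, x⟫_𝕜 := by
  refine exists_inner_basis_eq b (Summable.of_nonneg_of_le (fun i => by positivity) (fun i => ?_)
    ((hasSum_norm_inner_basis_sq b x).summable.mul_left (C ^ 2)))
  rw [norm_mul, mul_pow]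
  gcongr
  exact hm i

theorem exists_diagonal_operator {m : ι → 𝕜} {C : ℝ} (hC : 0 ≤ C) (hm : ∀ i, ‖m i‖ ≤ C) :
    ∃ T : H →L[𝕜] H, ‖T‖ ≤ C ∧ ∀ x i, ⟪b i, T x⟫_𝕜 = m i * ⟪b i, x⟫_𝕜 := by
  choose T hT using exists_inner_basis_eq_mul b hm
  let L : H →ₗ[𝕜] H :=
    { toFun := T
      map_add' := fun x y => eq_of_inner_basis_eq b fun i => by
        simp only [inner_add_right, hT, mul_add]
      map_smul' := fun a x => eq_of_inner_basis_eq b fun i => by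
        simp only [inner_smul_right, hT, RingHom.id_apply, mul_left_comm] }
  have hL (x : H) : ‖L x‖ ≤ C * ‖x‖ := norm_le_of_norm_inner_basis_le b hC fun i => by
    rw [show L x = T x from rfl, hT, norm_mul]
    gcongr
    exact hm i
  exact ⟨L.mkContinuous C hL, L.mkContinuous_norm_le hC hL, hT⟩

/-- Dominated convergence for the coefficients with respect to a Hilbert basis. -/
theorem tendsto_of_tendsto_inner_basis {τ : Type*} {l : Filter τ} {f : τ → H} {y z : H} {C : ℝ}
    (hf : ∀ i, Tendsto (fun t => ⟪b i, f t⟫_𝕜) l (𝓝 ⟪b i, y⟫_𝕜))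
    (hC : ∀ᶠ t in l, ∀ i, ‖⟪b i, f t - y⟫_𝕜‖ ≤ C * ‖⟪b i, z⟫_𝕜‖) : Tendsto f l (𝓝 y) := by
  have hzero (i : ι) : Tendsto (fun t => ‖⟪b i, f t - y⟫_𝕜‖ ^ 2) l (𝓝 0) := by
    simpa [inner_sub_right] using (((hf i).sub_const ⟪b i, y⟫_𝕜).norm.pow 2)
  have h := tendsto_tsum_of_dominated_convergence (𝓕 := l)
    ((hasSum_norm_inner_basis_sq b z).summable.mul_left (C ^ 2)) hzero
    (hC.mono fun t ht i => by
      rw [norm_pow, norm_norm, ← mul_pow]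
      exact pow_le_pow_left₀ (norm_nonneg _) (ht i) 2)
  simp only [tsum_zero, (hasSum_norm_inner_basis_sq b _).tsum_eq] at h
  rw [tendsto_iff_norm_sub_tendsto_zero]
  simpa using h.sqrt

end HilbertBasisCoefficients

theorem eq_exp_mul_of_eq_add_integral {g : ℝ → ℝ} (hg : Continuous g) {a r : ℝ}
    (h : ∀ t, 0 ≤ t → g t = a + r * ∫ s in (0 : ℝ)..t, g s) {t : ℝ} (ht : 0 ≤ t) :
    g t = Real.exp (r * t) * a := by
  set G : ℝ → ℝ := fun s => a + r * ∫ q in (0 : ℝ)..s, g q with hG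
  have hG_deriv (s : ℝ) : HasDerivAt G (r * g s) s :=
    ((hg.integral_hasStrictDerivAt 0 s).hasDerivAt.const_mul r).const_add a
  have hexp_deriv (s : ℝ) :
      HasDerivAt (fun s => Real.exp (-(r * s))) (-r * Real.exp (-(r * s))) s := by
    simpa [mul_comm] using ((hasDerivAt_id s).const_mul r).neg.exp
  have hprod_deriv (s : ℝ) := (hexp_deriv s).fun_mul (hG_deriv s)
  have hconst := constant_of_has_deriv_right_zero (a := 0) (b := t)
    (fun s _ => (hprod_deriv s).continuousAt.continuousWithinAt)
    (fun s hs => (hprod_deriv s).hasDerivWithinAt.congr_deriv (by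
      rw [h s hs.1]
      ring)) t ⟨ht, le_rfl⟩
  rw [h t ht, ← inv_mul_eq_iff_eq_mul₀ (Real.exp_ne_zero _), ← Real.exp_neg]
  simpa [hG] using hconst

/-! ### `C₀`-semigroups and their generators -/

section Semigroups

variable {X : Type*} [NormedAddCommGroup X] [InnerProductSpace ℝ X] {S : ℝ → X →L[ℝ] X}

namespace IsC0Semigroup

theorem norm_apply_sub_apply_le (hS : IsC0Semigroup S) {M : ℝ} (hM : ∀ t, 0 ≤ t → ‖S t‖ ≤ M)
    (y : X) {s t : ℝ} (hs : 0 ≤ s) (ht : 0 ≤ t) : ‖S t y - S s y‖ ≤ M * ‖S |t - s| y - y‖ := by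
  wlog h : s ≤ t generalizing s t
  · rw [norm_sub_rev, abs_sub_comm]
    exact this ht hs (le_of_not_ge h)
  have hts : S t y = S s (S (t - s) y) := by
    rw [← ContinuousLinearMap.comp_apply, ← hS.map_add s (t - s) hs (by linarith),
      add_sub_cancel]
  rw [abs_of_nonneg (by linarith), hts, ← map_sub]
  exact (S s).le_of_opNorm_le (hM s hs) _

theorem continuousOn_orbit (hS : IsC0Semigroup S) {M : ℝ} (hM : ∀ t, 0 ≤ t → ‖S t‖ ≤ M)
    (y : X) : ContinuousOn (fun t => S t y) (Ici 0) := by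
  have hzero : Tendsto (fun t => S t y) (𝓝[≥] 0) (𝓝 y) := by
    have : ContinuousWithinAt (fun t => S t y) (Ioi 0) 0 := by
      simpa [ContinuousWithinAt, hS.map_zero] using hS.tendsto_zero y
    simpa [ContinuousWithinAt, hS.map_zero] using continuousWithinAt_Ioi_iff_Ici.1 this
  intro s hs
  have habs : Tendsto (fun t : ℝ => |t - s|) (𝓝[Ici 0] s) (𝓝[≥] 0) := by
    refine tendsto_nhdsWithin_iff.2 ⟨?_, Eventually.of_forall fun t => mem_Ici.2 (abs_nonneg _)⟩
    have : Continuous fun t : ℝ => |t - s| := by fun_prop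
    simpa using (this.tendsto s).mono_left nhdsWithin_le_nhds
  rw [ContinuousWithinAt, tendsto_iff_norm_sub_tendsto_zero]
  refine squeeze_zero' (Eventually.of_forall fun t => norm_nonneg _) ?_
    (by simpa using ((hzero.comp habs).sub_const y).norm.const_mul M :
      Tendsto (fun t => M * ‖S |t - s| y - y‖) (𝓝[Ici 0] s) (𝓝 0))
  filter_upwards [self_mem_nhdsWithin] with t ht
  exact hS.norm_apply_sub_apply_le hM y hs ht

theorem continuous_orbit (hS : IsC0Semigroup S) {M : ℝ} (hM : ∀ t, 0 ≤ t → ‖S t‖ ≤ M) (y : X) :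
    Continuous fun t => S (max t 0) y :=
  (hS.continuousOn_orbit hM y).comp_continuous (by fun_prop) fun t => le_max_right t 0

/-- The mean of an orbit lies in the domain of the generator. -/
theorem tendsto_slope_integral_orbit [CompleteSpace X] (hS : IsC0Semigroup S) {M : ℝ}
    (hM : ∀ t, 0 ≤ t → ‖S t‖ ≤ M) (y : X) {r : ℝ} (hr : 0 ≤ r) :
    Tendsto (fun t : ℝ => t⁻¹ • (S t (∫ s in (0 : ℝ)..r, S (max s 0) y)
      - ∫ s in (0 : ℝ)..r, S (max s 0) y)) (𝓝[>] 0) (𝓝 (S r y - y)) := by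
  have hc := hS.continuous_orbit hM y
  set F : ℝ → X := fun t => ∫ s in (0 : ℝ)..t, S (max s 0) y with hF
  have hslope (u : ℝ) : Tendsto (fun t : ℝ => t⁻¹ • (F (u + t) - F u)) (𝓝[>] 0)
      (𝓝 (S (max u 0) y)) :=
    (hc.integral_hasStrictDerivAt 0 u).hasDerivAt.tendsto_slope_zero_right
  have hshift {t : ℝ} (ht : 0 ≤ t) : S t (F r) = F (r + t) - F t := by
    rw [hF, intervalIntegral.integral_interval_sub_left (hc.intervalIntegrable _ _)
      (hc.intervalIntegrable _ _), ← zero_add t, ← add_assoc, add_zero,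
      ← intervalIntegral.integral_comp_add_right, zero_add,
      ← ContinuousLinearMap.intervalIntegral_comp_comm _ (hc.intervalIntegrable _ _)]
    refine intervalIntegral.integral_congr fun s hs => ?_
    have hs0 : 0 ≤ s := (uIcc_of_le hr ▸ hs).1
    rw [← ContinuousLinearMap.comp_apply, max_eq_left hs0, max_eq_left (add_nonneg hs0 ht),
      ← hS.map_add t s ht hs0, add_comm]
  have hF0 : F 0 = 0 := intervalIntegral.integral_same
  have hlim := (hslope r).sub (hslope 0)
  simp only [max_eq_left hr, max_self, hS.map_zero, ContinuousLinearMap.id_apply, zero_add, hF0,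
    sub_zero] at hlim
  refine hlim.congr' ?_
  filter_upwards [self_mem_nhdsWithin] with t ht
  rw [hshift (le_of_lt ht)]
  module

theorem inner_apply_of_eigenvector [CompleteSpace X] (hS : IsC0Semigroup S) {M : ℝ}
    (hM : ∀ t, 0 ≤ t → ‖S t‖ ≤ M) {G : X → X → Prop} (hG : IsGeneratorOf G S) {w : X} {r : ℝ}
    (hw : ∀ x z, G x z → ⟪w, z⟫_ℝ = r * ⟪w, x⟫_ℝ) (y : X) {t : ℝ} (ht : 0 ≤ t) :
    ⟪w, S t y⟫_ℝ = Real.exp (r * t) * ⟪w, y⟫_ℝ := by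
  have hc := hS.continuous_orbit hM y
  have hcw : Continuous fun s => ⟪w, S (max s 0) y⟫_ℝ := continuous_const.inner hc
  suffices h : ∀ s, 0 ≤ s → ⟪w, S (max s 0) y⟫_ℝ
      = ⟪w, y⟫_ℝ + r * ∫ q in (0 : ℝ)..s, ⟪w, S (max q 0) y⟫_ℝ by
    simpa only [max_eq_left ht] using eq_exp_mul_of_eq_add_integral hcw h ht
  intro s hs
  have h := hw _ _ ((hG _ _).2 (hS.tendsto_slope_integral_orbit hM y hs))
  have hcomm := (innerSL ℝ w).intervalIntegral_comp_comm (μ := volume) (hc.intervalIntegrable 0 s)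
  simp only [innerSL_apply_apply] at hcomm
  rw [inner_sub_right, ← hcomm] at h
  rw [max_eq_left hs]
  linarith

theorem conj (hS : IsC0Semigroup S) (V : X ≃L[ℝ] X) :
    IsC0Semigroup fun t => ((V : X →L[ℝ] X).comp (S t)).comp (V.symm : X →L[ℝ] X) where
  map_zero := by
    ext x
    simp [hS.map_zero]
  map_add s t hs ht := by
    ext x
    simp [hS.map_add s t hs ht]
  tendsto_zero x := by
    simpa [Function.comp_def] using (V.continuous.tendsto _).comp (hS.tendsto_zero (V.symm x))

end IsC0Semigroup

theorem IsGeneratorOf.conj {G : X → X → Prop} (hG : IsGeneratorOf G S) (V : X ≃L[ℝ] X) :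
    IsGeneratorOf (fun x z => G (V.symm x) (V.symm z))
      fun t => ((V : X →L[ℝ] X).comp (S t)).comp (V.symm : X →L[ℝ] X) := by
  intro x z
  have hslope (t : ℝ) : t⁻¹ • (((V : X →L[ℝ] X).comp (S t)).comp (V.symm : X →L[ℝ] X) x - x)
      = V (t⁻¹ • (S t (V.symm x) - V.symm x)) := by simp
  simp only [hG _ _, hslope]
  rw [V.toHomeomorph.isInducing.tendsto_nhds_iff]
  simp [Function.comp_def]

end Semigroups

theorem tendsto_inv_mul_exp_sub_one (r : ℝ) :
    Tendsto (fun t : ℝ => t⁻¹ * (Real.exp (r * t) - 1)) (𝓝[>] 0) (𝓝 r) := by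
  have h : HasDerivAt (fun t : ℝ => Real.exp (r * t)) r 0 := by
    simpa using ((hasDerivAt_id (0 : ℝ)).const_mul r).exp
  simpa using h.tendsto_slope_zero_right

theorem abs_exp_sub_one_le_of_le {x y : ℝ} (hxy : x ≤ y) (hy : 0 ≤ y) :
    |Real.exp x - 1| ≤ |x| * Real.exp y := by
  have h1 := Real.add_one_le_exp x
  have h2 : Real.exp x * (1 - x) ≤ 1 := by
    have h := mul_le_mul_of_nonneg_left (Real.add_one_le_exp (-x)) (Real.exp_pos x).le
    rw [← Real.exp_add, add_neg_cancel, Real.exp_zero] at h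
    linarith
  have h3 := Real.exp_le_exp.2 hxy
  have h4 := Real.one_le_exp hy
  rcases le_total 0 x with hx | hx
  · rw [abs_of_nonneg (by linarith), abs_of_nonneg hx]
    nlinarith
  · rw [abs_of_nonpos (by linarith [Real.exp_le_one_iff.2 hx]), abs_of_nonpos hx]
    nlinarith

theorem eventually_abs_exp_mul_sub_one_le (κ : ℝ) :
    ∀ᶠ t : ℝ in 𝓝[>] 0, ∀ r ≤ κ, |Real.exp (r * t) - 1| ≤ t * |r| * Real.exp |κ| := by
  filter_upwards [Ioo_mem_nhdsGT zero_lt_one] with t ht r hr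
  have hrt : r * t ≤ |κ| :=
    (mul_le_mul_of_nonneg_right (hr.trans (le_abs_self κ)) ht.1.le).trans
      (mul_le_of_le_one_right (abs_nonneg κ) ht.2.le)
  simpa [abs_mul, abs_of_pos ht.1, mul_comm] using
    abs_exp_sub_one_le_of_le hrt (abs_nonneg κ)

section DiagonalSemigroups

variable {ι H : Type*} [NormedAddCommGroup H] [InnerProductSpace ℝ H]
  (b : HilbertBasis ι ℝ H) {ν : ι → ℝ} {κ : ℝ}

theorem exists_diagonal_semigroup (hν : ∀ i, ν i ≤ κ) :
    ∃ S : ℝ → H →L[ℝ] H, ∀ t, 0 ≤ t → ‖S t‖ ≤ Real.exp (κ * t) ∧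
      ∀ x i, ⟪b i, S t x⟫_ℝ = Real.exp (ν i * t) * ⟪b i, x⟫_ℝ := by
  have key (t : ℝ) : ∃ T : H →L[ℝ] H, 0 ≤ t → ‖T‖ ≤ Real.exp (κ * t) ∧
      ∀ x i, ⟪b i, T x⟫_ℝ = Real.exp (ν i * t) * ⟪b i, x⟫_ℝ := by
    by_cases ht : 0 ≤ t
    · obtain ⟨T, hT⟩ := exists_diagonal_operator b (m := fun i => Real.exp (ν i * t))
        (Real.exp_pos (κ * t)).le (fun i => by
          rw [Real.norm_of_nonneg (Real.exp_pos _).le]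
          exact Real.exp_le_exp.2 (mul_le_mul_of_nonneg_right (hν i) ht))
      exact ⟨T, fun _ => hT⟩
    · exact ⟨0, fun h => absurd h ht⟩
  choose S hS using key
  exact ⟨S, hS⟩

variable {S : ℝ → H →L[ℝ] H}
  (hS : ∀ t, 0 ≤ t → ∀ x i, ⟪b i, S t x⟫_ℝ = Real.exp (ν i * t) * ⟪b i, x⟫_ℝ)
include hS

theorem tendsto_inner_slope_of_diagonal (x : H) (i : ι) :
    Tendsto (fun t : ℝ => ⟪b i, t⁻¹ • (S t x - x)⟫_ℝ) (𝓝[>] 0) (𝓝 (ν i * ⟪b i, x⟫_ℝ)) := by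
  refine ((tendsto_inv_mul_exp_sub_one (ν i)).mul_const _).congr' ?_
  filter_upwards [self_mem_nhdsWithin] with t ht
  rw [real_inner_smul_right, inner_sub_right, hS t (le_of_lt ht)]
  ring

theorem IsC0Semigroup.of_diagonal (hν : ∀ i, ν i ≤ κ) : IsC0Semigroup S where
  map_zero := by
    ext x
    exact eq_of_inner_basis_eq b fun i => by simp [hS 0 le_rfl]
  map_add s t hs ht := by
    ext x
    refine eq_of_inner_basis_eq b fun i => ?_
    rw [ContinuousLinearMap.comp_apply, hS _ (add_nonneg hs ht), hS s hs, hS t ht, mul_add,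
      Real.exp_add, mul_assoc]
  tendsto_zero x := by
    refine tendsto_of_tendsto_inner_basis b (z := x) (C := Real.exp |κ| + 1) (fun i => ?_) ?_
    · have h : Continuous fun t : ℝ => Real.exp (ν i * t) * ⟪b i, x⟫_ℝ := by fun_prop
      refine ((by simpa using h.tendsto 0 : Tendsto _ _ (𝓝 ⟪b i, x⟫_ℝ)).mono_left
        nhdsWithin_le_nhds).congr' ?_
      filter_upwards [self_mem_nhdsWithin] with t ht
      exact (hS t (le_of_lt ht) x i).symm
    · filter_upwards [Ioo_mem_nhdsGT zero_lt_one] with t ht i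
      have hexp : Real.exp (ν i * t) ≤ Real.exp |κ| := Real.exp_le_exp.2 <|
        (mul_le_mul_of_nonneg_right ((hν i).trans (le_abs_self κ)) ht.1.le).trans
          (mul_le_of_le_one_right (abs_nonneg κ) ht.2.le)
      rw [inner_sub_right, hS t ht.1.le, ← sub_one_mul, norm_mul]
      gcongr
      rw [Real.norm_eq_abs, abs_le]
      constructor <;> linarith [Real.exp_pos (ν i * t), Real.exp_pos |κ|]

theorem IsGeneratorOf.of_diagonal (hν : ∀ i, ν i ≤ κ) :
    IsGeneratorOf (fun x z => ∀ i, ⟪b i, z⟫_ℝ = ν i * ⟪b i, x⟫_ℝ) S := by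
  refine fun x z => ⟨fun h => ?_, fun h i => ?_⟩
  · refine tendsto_of_tendsto_inner_basis b (z := z) (C := Real.exp |κ| + 1) (fun i => ?_) ?_
    · rw [h i]
      exact tendsto_inner_slope_of_diagonal b hS x i
    · filter_upwards [self_mem_nhdsWithin, eventually_abs_exp_mul_sub_one_le κ] with t ht hexp i
      have ht0 : 0 < t := ht
      have hslope : ⟪b i, t⁻¹ • (S t x - x) - z⟫_ℝ
          = (t⁻¹ * (Real.exp (ν i * t) - 1) - ν i) * ⟪b i, x⟫_ℝ := by
        rw [inner_sub_right, real_inner_smul_right, inner_sub_right, hS t ht0.le, h i]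
        ring
      rw [hslope, h i, norm_mul, norm_mul, ← mul_assoc]
      gcongr
      calc ‖t⁻¹ * (Real.exp (ν i * t) - 1) - ν i‖
          ≤ t⁻¹ * |Real.exp (ν i * t) - 1| + |ν i| := by
            simpa [abs_mul, abs_inv, abs_of_pos ht0] using
              norm_sub_le (t⁻¹ * (Real.exp (ν i * t) - 1)) (ν i)
        _ ≤ t⁻¹ * (t * |ν i| * Real.exp |κ|) + |ν i| := by
            gcongr
            exact hexp _ (hν i)
        _ = (Real.exp |κ| + 1) * ‖ν i‖ := by
            rw [Real.norm_eq_abs]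
            field_simp
  · exact tendsto_nhds_unique (((continuous_const.inner continuous_id).tendsto z).comp h)
      (tendsto_inner_slope_of_diagonal b hS x i)

end DiagonalSemigroups

theorem memLp_exp_neg {α : ℝ} (hα : 0 < α) :
    MemLp (fun t : ℝ => Real.exp (-α * t)) 2 (volume.restrict (Ioi 0)) := by
  rw [memLp_two_iff_integrable_sq (by fun_prop)]
  refine (integrableOn_exp_mul_Ioi (a := -(2 * α)) (by linarith) 0).congr_fun (fun t _ => ?_)
    measurableSet_Ioi
  simp only
  rw [← Real.exp_nat_mul]
  ring_nf

section BoundedFeedback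

variable {X U : Type*} [NormedAddCommGroup X] [InnerProductSpace ℝ X]
  [NormedAddCommGroup U] [InnerProductSpace ℝ U] {S : ℝ → X →L[ℝ] X} {C α : ℝ}

theorem norm_le_of_decay (hα : 0 ≤ α) (hdecay : ∀ t, 0 ≤ t → ‖S t‖ ≤ C * Real.exp (-α * t))
    {t : ℝ} (ht : 0 ≤ t) : ‖S t‖ ≤ C := by
  have hC : 0 ≤ C := by simpa using (norm_nonneg _).trans (hdecay 0 le_rfl)
  exact (hdecay t ht).trans (mul_le_of_le_one_right hC (Real.exp_le_one_iff.2 (by nlinarith)))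

theorem IsC0Semigroup.exists_eLpNorm_comp_orbit_le (hS : IsC0Semigroup S) (hα : 0 < α)
    (hdecay : ∀ t, 0 ≤ t → ‖S t‖ ≤ C * Real.exp (-α * t)) (k : X →L[ℝ] U) :
    ∃ D : ℝ, 0 < D ∧ ∀ y, MemLp (fun t => k (S t y)) 2 (volume.restrict (Ioi 0)) ∧
      eLpNorm (fun t => k (S t y)) 2 (volume.restrict (Ioi 0)) ≤ ENNReal.ofReal (D * ‖y‖) := by
  have hexp := memLp_exp_neg hα
  have hC : 0 ≤ C := by simpa using (norm_nonneg _).trans (hdecay 0 le_rfl)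
  set R := (eLpNorm (fun t : ℝ => Real.exp (-α * t)) 2 (volume.restrict (Ioi 0))).toReal with hR
  have : 0 ≤ R := ENNReal.toReal_nonneg
  refine ⟨‖k‖ * C * R + 1, by positivity, fun y => ?_⟩
  have hmeas : AEStronglyMeasurable (fun t => k (S t y)) (volume.restrict (Ioi 0)) :=
    (k.continuous.comp_continuousOn ((hS.continuousOn_orbit
      (fun _ => norm_le_of_decay hα.le hdecay) y).mono Ioi_subset_Ici_self)).aestronglyMeasurable
      measurableSet_Ioi
  have hbound : ∀ᵐ t ∂(volume.restrict (Ioi (0 : ℝ))),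
      ‖k (S t y)‖ ≤ ‖k‖ * C * ‖y‖ * ‖Real.exp (-α * t)‖ := by
    filter_upwards [ae_restrict_mem measurableSet_Ioi] with t ht
    rw [Real.norm_of_nonneg (Real.exp_pos _).le]
    calc ‖k (S t y)‖ ≤ ‖k‖ * ‖S t y‖ := k.le_opNorm _
      _ ≤ ‖k‖ * (C * Real.exp (-α * t) * ‖y‖) := by
          gcongr
          exact (S t).le_of_opNorm_le (hdecay t (le_of_lt ht)) y
      _ = ‖k‖ * C * ‖y‖ * Real.exp (-α * t) := by ring
  refine ⟨MemLp.of_le_mul hexp hmeas hbound,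
    (eLpNorm_le_mul_eLpNorm_of_ae_le_mul hbound 2).trans ?_⟩
  rw [← ENNReal.ofReal_toReal hexp.eLpNorm_ne_top, ← hR, ← ENNReal.ofReal_mul (by positivity)]
  refine ENNReal.ofReal_le_ofReal ?_
  linarith [norm_nonneg y]

variable [CompleteSpace X] {A : X →ₗ.[ℝ] X} {B : U →L[ℝ] ExtrapolationSpace A}

theorem IsStabilizingFeedback.of_bounded {k : X →L[ℝ] U} (hα : 0 < α) (hC : 0 < C)
    (hS : IsC0Semigroup S)
    (hG : IsGeneratorOf (IsClosedLoop A B ((k : X →ₗ[ℝ] U).toPMap ⊤)) S)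
    (hdecay : ∀ t, 0 ≤ t → ‖S t‖ ≤ C * Real.exp (-α * t)) :
    IsStabilizingFeedback A B α ((k : X →ₗ[ℝ] U).toPMap ⊤) S := by
  have hk (x z : X) : ‖k x‖ ≤ ‖k‖ * (‖x‖ + ‖z‖) := (k.le_opNorm x).trans
    (mul_le_mul_of_nonneg_left (le_add_of_nonneg_right (norm_nonneg _)) (norm_nonneg _))
  obtain ⟨D, hD, hcontrol⟩ := hS.exists_eLpNorm_comp_orbit_le hα hdecay k
  exact
    { domain_le := le_top
      bounded_domain := ⟨‖k‖, fun x _ => hk x (A x)⟩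
      semigroup := hS
      generator := hG
      decay := ⟨C, hC, hdecay⟩
      bounded_closedLoop := ⟨‖k‖, fun x z _ _ => hk x z⟩
      control_bound := ⟨D, hD, fun y _ _ =>
        ⟨fun t => k (S t y),
          fun t _ => ((k : X →ₗ[ℝ] U).toPMap ⊤).mem_graph ⟨S t y, trivial⟩, hcontrol y⟩⟩ }

end BoundedFeedback

/-! ### Operators with an orthonormal eigenbasis -/

/-- `b` is an orthonormal basis of eigenvectors of `A` with eigenvalues `l`. The second condition
says that `A` acts on coefficients as multiplication by `l`; it holds as soon as `A` is symmetric,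
and it makes `A` a restriction of the maximal diagonal operator. -/
structure IsEigenbasis {ι X : Type*} [NormedAddCommGroup X] [InnerProductSpace ℝ X]
    (A : X →ₗ.[ℝ] X) (b : HilbertBasis ι ℝ X) (l : ι → ℝ) : Prop where
  mem_graph : ∀ n, (b n, l n • b n) ∈ A.graph
  inner_snd : ∀ p ∈ A.graph, ∀ n, ⟪b n, p.2⟫_ℝ = l n * ⟪b n, p.1⟫_ℝ

namespace IsEigenbasis

variable {ι X U : Type*} [NormedAddCommGroup X] [InnerProductSpace ℝ X]
  [NormedAddCommGroup U] [InnerProductSpace ℝ U] {A : X →ₗ.[ℝ] X} {b : HilbertBasis ι ℝ X}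
  {l : ι → ℝ}

theorem dense_domain (h : IsEigenbasis A b l) : Dense (A.domain : Set X) := by
  rw [Submodule.dense_iff_topologicalClosure_eq_top, eq_top_iff, ← b.dense_span]
  refine Submodule.topologicalClosure_mono (Submodule.span_le.2 ?_)
  rintro _ ⟨n, rfl⟩
  exact LinearPMap.mem_domain_of_mem_graph (h.mem_graph n)

variable [CompleteSpace X]

theorem mem_adjoint_graph_iff (h : IsEigenbasis A b l) {p : X × X} :
    p ∈ A.adjoint.graph ↔ ∀ n, ⟪b n, p.2⟫_ℝ = l n * ⟪b n, p.1⟫_ℝ := by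
  rw [LinearPMap.adjoint_graph_eq_graph_adjoint h.dense_domain, Submodule.mem_adjoint_iff]
  refine ⟨fun hp n => ?_, fun hp x z hxz => ?_⟩
  · have := hp _ _ (h.mem_graph n)
    rw [real_inner_smul_left] at this
    linarith
  · rw [sub_eq_zero, ← b.tsum_inner_mul_inner, ← b.tsum_inner_mul_inner]
    refine tsum_congr fun n => ?_
    rw [hp n, real_inner_comm, h.inner_snd _ hxz n, real_inner_comm x]
    ring

/-- The eigenpair `(b n, A* b n)`, as an element of `D(A*)` identified with the graph of `A*`. -/
def adjointMode (h : IsEigenbasis A b l) (n : ι) : A.adjoint.graph :=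
  ⟨(b n, l n • b n), h.mem_adjoint_graph_iff.2 (h.inner_snd _ (h.mem_graph n))⟩

theorem hasSum_adjointMode (h : IsEigenbasis A b l) (φ : A.adjoint.graph) :
    HasSum (fun n => ⟪b n, (φ : X × X).1⟫_ℝ • h.adjointMode n) φ := by
  have h1 := b.hasSum_repr (φ : X × X).1
  have h2 := b.hasSum_repr (φ : X × X).2
  simp only [b.repr_apply_apply, h.mem_adjoint_graph_iff.1 φ.2] at h1 h2
  refine (Topology.IsInducing.subtypeVal.hasSum_iff (g := A.adjoint.graph.subtype) _ _).1 ?_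
  convert! h1.prodMk h2 using 2 with n
  simp [adjointMode, smul_smul, mul_comm]

theorem extrapolation_ext (h : IsEigenbasis A b l) {F G : ExtrapolationSpace A}
    (hFG : ∀ n, F (h.adjointMode n) = G (h.adjointMode n)) : F = G := by
  ext φ
  have hF := (h.hasSum_adjointMode φ).mapL F
  have hG := (h.hasSum_adjointMode φ).mapL G
  simp only [map_smul, hFG] at hF hG
  exact hF.unique hG

theorem isClosedLoop_iff (h : IsEigenbasis A b l) {B : U →L[ℝ] ExtrapolationSpace A}
    {K : X →ₗ.[ℝ] U} {x z : X} :
    IsClosedLoop A B K x z ↔ ∃ hx : x ∈ K.domain, ∀ n,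
      l n * ⟪b n, x⟫_ℝ + B (K ⟨x, hx⟩) (h.adjointMode n) = ⟪b n, z⟫_ℝ := by
  refine exists_congr fun hx => ?_
  let F : ExtrapolationSpace A := ((innerSL ℝ x).comp (ContinuousLinearMap.snd ℝ X X)).comp
    A.adjoint.graph.subtypeL + B (K ⟨x, hx⟩)
  let G : ExtrapolationSpace A := ((innerSL ℝ z).comp (ContinuousLinearMap.fst ℝ X X)).comp
    A.adjoint.graph.subtypeL
  have hF (n : ι) : F (h.adjointMode n)
      = l n * ⟪b n, x⟫_ℝ + B (K ⟨x, hx⟩) (h.adjointMode n) := by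
    rw [real_inner_comm, ← real_inner_smul_right]
    rfl
  have hG (n : ι) : G (h.adjointMode n) = ⟪b n, z⟫_ℝ := real_inner_comm _ _
  calc (∀ φ : A.adjoint.graph, F φ = G φ) ↔ F = G := DFunLike.ext_iff.symm
    _ ↔ ∀ n, F (h.adjointMode n) = G (h.adjointMode n) :=
      ⟨fun hFG n => by rw [hFG], h.extrapolation_ext⟩
    _ ↔ _ := forall_congr' fun n => by rw [hF, hG]

theorem not_isStabilizingFeedback (h : IsEigenbasis A b l) {B : U →L[ℝ] ExtrapolationSpace A}
    {n : ι} (hn : ∀ u, B u (h.adjointMode n) = 0) {α : ℝ} (hα : 0 ≤ α) (hαn : -α < l n)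
    (K : X →ₗ.[ℝ] U) (S : ℝ → X →L[ℝ] X) : ¬IsStabilizingFeedback A B α K S := by
  intro hK
  obtain ⟨C, -, hdecay⟩ := hK.decay
  have hfree {t : ℝ} (ht : 0 ≤ t) := hK.semigroup.inner_apply_of_eigenvector
    (fun _ => norm_le_of_decay hα hdecay) hK.generator (w := b n) (r := l n)
    (fun x z hxz => by
      obtain ⟨hx, hxz⟩ := h.isClosedLoop_iff.1 hxz
      rw [← hxz n, hn, add_zero]) (b n) ht
  have hbound {t : ℝ} (ht : 0 ≤ t) : Real.exp (l n * t) ≤ C * Real.exp (-α * t) := by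
    calc Real.exp (l n * t) = ⟪b n, S t (b n)⟫_ℝ := by simp [hfree ht, b.orthonormal.1 n]
      _ ≤ ‖b n‖ * ‖S t (b n)‖ := real_inner_le_norm _ _
      _ ≤ C * Real.exp (-α * t) := by
        simpa [b.orthonormal.1 n] using (S t).le_of_opNorm_le (hdecay t ht) (b n)
  have hgrowth : Tendsto (fun t => Real.exp ((l n + α) * t)) atTop atTop :=
    Real.tendsto_exp_atTop.comp (tendsto_id.const_mul_atTop (by linarith))
  obtain ⟨t, ht, hCt⟩ := ((eventually_ge_atTop 0).and (hgrowth.eventually_gt_atTop C)).exists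
  refine (hbound ht).not_gt ?_
  calc C * Real.exp (-α * t) < Real.exp ((l n + α) * t) * Real.exp (-α * t) := by gcongr
    _ = Real.exp (l n * t) := by
      rw [← Real.exp_add]
      ring_nf

end IsEigenbasis

theorem exists_continuousLinearEquiv_eq_one_add {𝕜 X : Type*} [NontriviallyNormedField 𝕜]
    [NormedAddCommGroup X] [NormedSpace 𝕜 X] [CompleteSpace X] {T : X →L[𝕜] X}
    (hT : IsCompactOperator T) (hinj : Function.Injective (1 + T : X →L[𝕜] X)) :
    ∃ V : X ≃L[𝕜] X, (V : X →L[𝕜] X) = 1 + T := by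
  have hne : ¬Module.End.HasEigenvalue (T : X →ₗ[𝕜] X) (-1) := fun h => by
    obtain ⟨x, hx⟩ := h.exists_hasEigenvector
    refine hx.2 (hinj ?_)
    have hTx : T x = -1 • x := by simpa using hx.apply_eq_smul
    simp [hTx]
  have hunit : IsUnit (1 + T) := by
    have h := (hT.hasEigenvalue_or_mem_resolventSet (neg_ne_zero.2 one_ne_zero)).resolve_left hne
    rw [spectrum.mem_resolventSet_iff, map_neg, map_one, ← neg_add', IsUnit.neg_iff] at h
    exact h
  obtain ⟨V, hV⟩ := hunit
  exact ⟨ContinuousLinearEquiv.ofUnit V, hV⟩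

theorem isCompactOperator_sum_smulRight {𝕜 X ι : Type*} [RCLike 𝕜] [NormedAddCommGroup X]
    [NormedSpace 𝕜 X] (s : Finset ι) (f : ι → StrongDual 𝕜 X) (v : ι → X) :
    IsCompactOperator (∑ j ∈ s, (f j).smulRight (v j) : X →L[𝕜] X) := by
  refine (compactOperator (RingHom.id 𝕜) X X).sum_mem fun j _ => ?_
  exact (isCompactOperator_of_locallyCompactSpace_rng
    (ContinuousLinearMap.toSpanSingleton 𝕜 (v j))).comp_clm (f j)

/-! ### Pole placement in modal coordinates -/

section ModalMap

variable {ι F : Type*} [Field F] {s : Finset ι} {l m β : ι → F}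

/-- Nonsingularity of the Cauchy matrix with entries `1 / (l i - m j)`. -/
theorem eq_zero_of_sum_div_sub_eq_zero (hl : InjOn l s) (hm : InjOn m s)
    (hlm : ∀ i ∈ s, ∀ j ∈ s, l i ≠ m j) {a : ι → F}
    (h : ∀ i ∈ s, ∑ j ∈ s, a j / (l i - m j) = 0) {j : ι} (hj : j ∈ s) : a j = 0 := by
  classical
  -- The sum is, up to the factor `∏ j ∈ s, (x - m j)`, the polynomial of degree less than `#s`
  -- interpolating the values `a j / w j` at the nodes `m j`, where `w` are the nodal weights.
  set P := Lagrange.interpolate s m fun j => a j / Lagrange.nodalWeight s m j with hP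
  have hw {i : ι} (hi : i ∈ s) := Lagrange.nodalWeight_ne_zero hm hi
  have hroot (i : ι) (hi : i ∈ s) : P.eval (l i) = 0 := by
    rw [Lagrange.eval_interpolate_not_at_node _ (hlm i hi), ← mul_zero, ← h i hi]
    congr 1
    refine Finset.sum_congr rfl fun j hj => ?_
    have := hw hj
    field_simp
  have hPzero : P = 0 := Polynomial.eq_zero_of_degree_lt_of_eval_index_eq_zero s hl
    (Lagrange.degree_interpolate_lt _ hm) hroot
  have hnode := Lagrange.eval_interpolate_at_node
    (fun j => a j / Lagrange.nodalWeight s m j) hm hj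
  rw [← hP, hPzero, Polynomial.eval_zero, eq_comm, div_eq_zero_iff] at hnode
  exact hnode.resolve_right (hw hj)

variable [DecidableEq ι]

/-- Pole placement on coefficient sequences: for the system `y' n = l n * y n + β n * u`, the map
sends modal coordinates, in which the closed-loop operator with eigenvalues `s.piecewise m l` is
diagonal, to the coordinates of the open-loop system. The eigenvector for `m j`, `j ∈ s`, is
`n ↦ β n / (l n - m j)`. -/
def modalMap (s : Finset ι) (l m β a : ι → F) (n : ι) : F :=
  β n * ∑ j ∈ s, a j / (l n - m j) + if n ∈ s then 0 else a n

theorem modalMap_sub (a a' : ι → F) :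
    modalMap s l m β (a - a') = modalMap s l m β a - modalMap s l m β a' := by
  ext n
  by_cases hn : n ∈ s <;>
    simp [modalMap, hn, sub_div, Finset.sum_sub_distrib, mul_sub, add_sub_add_comm]

theorem modalMap_injective (hl : InjOn l s) (hm : InjOn m s) (hlm : ∀ i ∈ s, ∀ j ∈ s, l i ≠ m j)
    (hβ : ∀ n ∈ s, β n ≠ 0) : Function.Injective (modalMap s l m β) := by
  suffices h : ∀ a, modalMap s l m β a = 0 → a = 0 from
    fun a a' ha => sub_eq_zero.1 (h _ (by rw [modalMap_sub, ha, sub_self]))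
  intro a ha
  have hs {j : ι} (hj : j ∈ s) : a j = 0 :=
    eq_zero_of_sum_div_sub_eq_zero hl hm hlm (fun i hi => by
      simpa [modalMap, hi, hβ i hi] using congrFun ha i) hj
  ext n
  by_cases hn : n ∈ s
  · exact hs hn
  · have hsum : ∑ j ∈ s, a j / (l n - m j) = 0 :=
      Finset.sum_eq_zero fun j hj => by rw [hs hj, zero_div]
    simpa [modalMap, hn, hsum] using congrFun ha n

theorem modalMap_mul (a : ι → F) {n : ι} (hn : ∀ j ∈ s, l n ≠ m j) :
    modalMap s l m β (s.piecewise m l * a) n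
      = l n * modalMap s l m β a n - (∑ j ∈ s, a j) * β n := by
  have hsum : ∑ j ∈ s, (s.piecewise m l * a) j / (l n - m j)
      = l n * ∑ j ∈ s, a j / (l n - m j) - ∑ j ∈ s, a j := by
    rw [Finset.mul_sum, ← Finset.sum_sub_distrib]
    refine Finset.sum_congr rfl fun j hj => ?_
    have := sub_ne_zero.2 (hn j hj)
    rw [Pi.mul_apply, s.piecewise_eq_of_mem _ _ hj]
    field_simp
    ring
  rw [modalMap, modalMap, hsum]
  by_cases hns : n ∈ s <;> simp [hns] <;> ring

end ModalMap

theorem exists_continuousLinearEquiv_modalMap {ι H : Type*} [DecidableEq ι]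
    [NormedAddCommGroup H] [InnerProductSpace ℝ H] [CompleteSpace H] (b : HilbertBasis ι ℝ H)
    {s : Finset ι} {l m β : ι → ℝ} (hinj : Function.Injective (modalMap s l m β)) {w : ι → H}
    (hw : ∀ j ∈ s, ∀ n, ⟪b n, w j⟫_ℝ = β n / (l n - m j)) :
    ∃ V : H ≃L[ℝ] H, ∀ x n, ⟪b n, V x⟫_ℝ = modalMap s l m β (fun i => ⟪b i, x⟫_ℝ) n := by
  set T : H →L[ℝ] H := ∑ j ∈ s, (innerSL ℝ (b j)).smulRight (w j - b j) with hT
  have hcoeff (x : H) (n : ι) :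
      ⟪b n, (1 + T) x⟫_ℝ = modalMap s l m β (fun i => ⟪b i, x⟫_ℝ) n := by
    have hsum : ∑ j ∈ s, ⟪b j, x⟫_ℝ * ⟪b n, w j⟫_ℝ
        = β n * ∑ j ∈ s, ⟪b j, x⟫_ℝ / (l n - m j) := by
      rw [Finset.mul_sum]
      exact Finset.sum_congr rfl fun j hj => by
        rw [hw j hj]
        ring
    have hdelta : ∑ j ∈ s, ⟪b j, x⟫_ℝ * ⟪b n, b j⟫_ℝ = if n ∈ s then ⟪b n, x⟫_ℝ else 0 := by
      simp [orthonormal_iff_ite.1 b.orthonormal]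
    simp only [hT, add_apply, one_apply_eq_self, sum_apply,
      ContinuousLinearMap.smulRight_apply, innerSL_apply_apply,
      inner_add_right, inner_sum, real_inner_smul_right, inner_sub_right, mul_sub,
      Finset.sum_sub_distrib, hsum, hdelta, modalMap]
    split_ifs <;> ring
  obtain ⟨V, hV⟩ := exists_continuousLinearEquiv_eq_one_add
    (isCompactOperator_sum_smulRight s (fun j => innerSL ℝ (b j)) fun j => w j - b j)
    fun x y hxy => eq_of_inner_basis_eq b (congrFun (hinj (funext fun n => by
      rw [← hcoeff x, ← hcoeff y, hxy])))
  exact ⟨V, fun x n => by rw [← hcoeff, ← hV, ContinuousLinearEquiv.coe_coe]⟩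

namespace IsEigenbasis

variable {ι X : Type*} [NormedAddCommGroup X] [InnerProductSpace ℝ X] [CompleteSpace X]
  {A : X →ₗ.[ℝ] X} {b : HilbertBasis ι ℝ X} {l : ι → ℝ}

/-- The resolvent of `A`, whose coefficients are divided by `l n - r`, maps `X₋₁` to `X`. -/
theorem exists_inner_eq_div (h : IsEigenbasis A b l) (hlim : Tendsto l cofinite atBot) {r : ℝ}
    (hr : r ∉ range l) (F : ExtrapolationSpace A) :
    ∃ w, ∀ n, ⟪b n, w⟫_ℝ = F (h.adjointMode n) / (l n - r) := by
  have hlr (n : ι) : l n - r ≠ 0 := sub_ne_zero.2 fun hn => hr ⟨n, hn⟩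
  obtain ⟨C, hC⟩ : BddAbove (range fun n => ‖(l n - r)⁻¹‖) :=
    (hlim.atBot_add tendsto_const_nhds).inv_tendsto_atBot.norm.bddAbove_range_of_cofinite
  obtain ⟨T, -, hT⟩ := exists_diagonal_operator b (abs_nonneg C)
    fun n => (hC (mem_range_self n)).trans (le_abs_self C)
  have hgraph (y : X) : (T y, y + r • T y) ∈ A.adjoint.graph :=
    h.mem_adjoint_graph_iff.2 fun n => by
      have := hlr n
      simp only [inner_add_right, real_inner_smul_right, hT]
      field_simp
      ring
  let R : X →L[ℝ] A.adjoint.graph :=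
    (T.prod (ContinuousLinearMap.id ℝ X + r • T)).codRestrict _ hgraph
  have hR (n : ι) : R (b n) = (l n - r)⁻¹ • h.adjointMode n := by
    have hTb : T (b n) = (l n - r)⁻¹ • b n := eq_of_inner_basis_eq b fun i => by
      rw [hT, real_inner_smul_right]
      obtain rfl | hin := eq_or_ne i n
      · rfl
      · simp [b.orthonormal.2 hin]
    refine Subtype.ext (Prod.ext hTb ?_)
    change b n + r • T (b n) = (l n - r)⁻¹ • l n • b n
    have := hlr n
    rw [hTb]
    match_scalars
    field_simp
    ring
  refine ⟨(InnerProductSpace.toDual ℝ X).symm (F.comp R), fun n => ?_⟩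
  rw [real_inner_comm, InnerProductSpace.toDual_symm_apply, ContinuousLinearMap.comp_apply, hR,
    map_smul, smul_eq_mul, inv_mul_eq_div]

theorem isClosedLoop_modal_iff [DecidableEq ι] (h : IsEigenbasis A b l)
    {B : ℝ →L[ℝ] ExtrapolationSpace A} {β : ι → ℝ} (hB : ∀ u n, B u (h.adjointMode n) = u * β n)
    {s : Finset ι} {m : ι → ℝ} (hlm : ∀ n, ∀ j ∈ s, l n ≠ m j)
    (hinj : Function.Injective (modalMap s l m β)) {V : X ≃L[ℝ] X}
    (hV : ∀ x n, ⟪b n, V x⟫_ℝ = modalMap s l m β (fun i => ⟪b i, x⟫_ℝ) n)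
    {k : X →L[ℝ] ℝ} (hk : ∀ x, k (V x) = -∑ j ∈ s, ⟪b j, x⟫_ℝ) (p q : X) :
    IsClosedLoop A B ((k : X →ₗ[ℝ] ℝ).toPMap ⊤) (V p) (V q) ↔
      ∀ n, ⟪b n, q⟫_ℝ = s.piecewise m l n * ⟪b n, p⟫_ℝ := by
  have hcoeff (n : ι) : l n * ⟪b n, V p⟫_ℝ + B (k (V p)) (h.adjointMode n)
      = modalMap s l m β (s.piecewise m l * fun i => ⟪b i, p⟫_ℝ) n := by
    rw [modalMap_mul _ (hlm n), hB, hk, hV]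
    ring
  calc IsClosedLoop A B ((k : X →ₗ[ℝ] ℝ).toPMap ⊤) (V p) (V q)
      ↔ ∀ n, l n * ⟪b n, V p⟫_ℝ + B (k (V p)) (h.adjointMode n) = ⟪b n, V q⟫_ℝ :=
        h.isClosedLoop_iff.trans ⟨fun ⟨_, hcl⟩ => hcl, fun hcl => ⟨trivial, hcl⟩⟩
    _ ↔ modalMap s l m β (s.piecewise m l * fun i => ⟪b i, p⟫_ℝ)
        = modalMap s l m β fun i => ⟪b i, q⟫_ℝ := by
      simp only [hcoeff, funext_iff, hV q]
    _ ↔ ∀ n, ⟪b n, q⟫_ℝ = s.piecewise m l n * ⟪b n, p⟫_ℝ := by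
      rw [hinj.eq_iff, funext_iff]
      exact forall_congr' fun n => eq_comm

theorem exists_isStabilizingFeedback [DecidableEq ι] (h : IsEigenbasis A b l)
    {B : ℝ →L[ℝ] ExtrapolationSpace A} {β : ι → ℝ} (hB : ∀ u n, B u (h.adjointMode n) = u * β n)
    {s : Finset ι} {m : ι → ℝ} (hlm : ∀ n, ∀ j ∈ s, l n ≠ m j)
    (hinj : Function.Injective (modalMap s l m β)) {V : X ≃L[ℝ] X}
    (hV : ∀ x n, ⟪b n, V x⟫_ℝ = modalMap s l m β (fun i => ⟪b i, x⟫_ℝ) n)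
    {α : ℝ} (hα : 0 < α) (hν : ∀ n, s.piecewise m l n ≤ -α) :
    ∃ K S, IsStabilizingFeedback A B α K S := by
  obtain ⟨E, hE⟩ := exists_diagonal_semigroup b hν
  have hEcoeff := fun t ht => (hE t ht).2
  let k : X →L[ℝ] ℝ := (-∑ j ∈ s, innerSL ℝ (b j)).comp (V.symm : X →L[ℝ] X)
  have hk (x : X) : k (V x) = -∑ j ∈ s, ⟪b j, x⟫_ℝ := by simp [k]
  have hG := (IsGeneratorOf.of_diagonal b hEcoeff hν).conj V
  have hcl (x z : X) := h.isClosedLoop_modal_iff hB hlm hinj hV hk (V.symm x) (V.symm z)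
  simp only [← hcl, ContinuousLinearEquiv.apply_symm_apply] at hG
  refine ⟨_, _, .of_bounded (C := ‖(V : X →L[ℝ] X)‖ * ‖(V.symm : X →L[ℝ] X)‖ + 1) hα
    (by positivity) ((IsC0Semigroup.of_diagonal b hEcoeff hν).conj V) hG fun t ht => ?_⟩
  calc _ ≤ ‖(V : X →L[ℝ] X)‖ * ‖E t‖ * ‖(V.symm : X →L[ℝ] X)‖ :=
        (ContinuousLinearMap.opNorm_comp_le _ _).trans
          (mul_le_mul_of_nonneg_right (ContinuousLinearMap.opNorm_comp_le _ _) (norm_nonneg _))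
    _ ≤ ‖(V : X →L[ℝ] X)‖ * Real.exp (-α * t) * ‖(V.symm : X →L[ℝ] X)‖ := by
      gcongr
      exact (hE t ht).1
    _ ≤ (‖(V : X →L[ℝ] X)‖ * ‖(V.symm : X →L[ℝ] X)‖ + 1) * Real.exp (-α * t) := by
      linarith [Real.exp_pos (-α * t)]

end IsEigenbasis

theorem control_apply_eq_mul {X : Type*} [NormedAddCommGroup X] [InnerProductSpace ℝ X]
    [CompleteSpace X] {A : X →ₗ.[ℝ] X} (B : ℝ →L[ℝ] ExtrapolationSpace A) (u : ℝ)
    (φ : A.adjoint.graph) : B u φ = u * B 1 φ := by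
  rw [← smul_eq_mul, ← _root_.smul_apply, ← map_smul, smul_eq_mul, mul_one]

theorem exists_injOn_lt_notMem_range {ι : Type*} {l : ι → ℝ} (hlim : Tendsto l cofinite atBot)
    {s : Set ι} (hs : s.Finite) (a : ℝ) :
    ∃ m : ι → ℝ, InjOn m s ∧ ∀ j ∈ s, m j < a ∧ m j ∉ range l := by
  have hfin : {n | ¬l n ≤ a - 1}.Finite := hlim.eventually (eventually_le_atBot (a - 1))
  have hinf : (Ioo (a - 1) a \ l '' {n | ¬l n ≤ a - 1}).Infinite :=
    (Ioo_infinite (sub_one_lt a)).sdiff (hfin.image l)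
  obtain ⟨m, hm, hinj⟩ := hs.exists_injOn_of_encard_le (hinf.encard_eq ▸ le_top)
  refine ⟨m, hinj, fun j hj => ⟨(hm hj).1.2, ?_⟩⟩
  rintro ⟨n, hn⟩
  exact (hm hj).2 ⟨n, not_le.2 (hn ▸ (hm hj).1.1), hn⟩

namespace IsEigenbasis

variable {ι X : Type*} [NormedAddCommGroup X] [InnerProductSpace ℝ X] [CompleteSpace X]
  {A : X →ₗ.[ℝ] X} {b : HilbertBasis ι ℝ X} {l : ι → ℝ}

theorem completelyStabilizable (h : IsEigenbasis A b l) (hl : Function.Injective l)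
    (hlim : Tendsto l cofinite atBot) {B : ℝ →L[ℝ] ExtrapolationSpace A}
    (hB : ∀ n, B 1 (h.adjointMode n) ≠ 0) : CompletelyStabilizable A B := by
  classical
  intro α hα
  have hfin : {n | ¬l n ≤ -α}.Finite := hlim.eventually (eventually_le_atBot (-α))
  set s := hfin.toFinset with hs
  obtain ⟨m, hm, hm_lt⟩ := exists_injOn_lt_notMem_range hlim s.finite_toSet (-α)
  have hlm (n : ι) (j : ι) (hj : j ∈ s) : l n ≠ m j := fun hn => (hm_lt j hj).2 ⟨n, hn⟩
  have hinj := modalMap_injective hl.injOn hm (fun i _ => hlm i) fun n _ => hB n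
  have hw (j : ι) : ∃ w, j ∈ s → ∀ n, ⟪b n, w⟫_ℝ = B 1 (h.adjointMode n) / (l n - m j) := by
    by_cases hj : j ∈ s
    · obtain ⟨w, hw⟩ := h.exists_inner_eq_div hlim (hm_lt j hj).2 (B 1)
      exact ⟨w, fun _ => hw⟩
    · exact ⟨0, fun hj' => absurd hj' hj⟩
  choose w hw using hw
  obtain ⟨V, hV⟩ := exists_continuousLinearEquiv_modalMap b hinj hw
  refine h.exists_isStabilizingFeedback (fun u n => ?_) hlm hinj hV hα fun n => ?_
  · exact control_apply_eq_mul B u _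
  · by_cases hn : n ∈ s
    · simpa [hn] using (hm_lt n hn).1.le
    · rw [s.piecewise_eq_of_notMem _ _ hn]
      simpa [hs] using hn

theorem completelyStabilizable_iff (h : IsEigenbasis A b l) (hl : Function.Injective l)
    (hlim : Tendsto l cofinite atBot) {B : ℝ →L[ℝ] ExtrapolationSpace A} :
    CompletelyStabilizable A B ↔ ∀ n, B 1 (h.adjointMode n) ≠ 0 := by
  refine ⟨fun hstab n hn => ?_, h.completelyStabilizable hl hlim⟩
  have hBn (u : ℝ) : B u (h.adjointMode n) = 0 := by rw [control_apply_eq_mul, hn, mul_zero]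
  obtain ⟨K, S, hK⟩ := hstab (|l n| + 1) (by positivity)
  exact h.not_isStabilizingFeedback hBn (by positivity) (by linarith [neg_abs_le (l n)]) K S hK

end IsEigenbasis

/-! ### Weak derivatives on `(0, 1)` -/

namespace PointHeat

theorem integral_eq_intervalIntegral (f : ℝ → ℝ) : ∫ x, f x ∂μ = ∫ x in (0 : ℝ)..1, f x := by
  rw [intervalIntegral.integral_of_le zero_le_one, integral_Ioc_eq_integral_Ioo]

theorem intervalIntegrable_state (g : State) : IntervalIntegrable g volume 0 1 := by
  rw [intervalIntegrable_iff_integrableOn_Ioo_of_le zero_le_one]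
  exact (Lp.memLp g).integrable one_le_two

theorem absolutelyContinuous_primitive (g : State) (a : ℝ) :
    AbsolutelyContinuousOnInterval (fun x => a + ∫ s in (0 : ℝ)..x, g s) 0 1 :=
  AbsolutelyContinuousOnInterval.fun_add
    (contDiff_const (n := 1)).contDiffOn.absolutelyContinuousOnInterval
    ((intervalIntegrable_state g).absolutelyContinuousOnInterval_intervalIntegral (by simp))

theorem continuousOn_primitive (g : State) (a : ℝ) :
    ContinuousOn (fun x => a + ∫ s in (0 : ℝ)..x, g s) (Icc 0 1) := by
  simpa using (absolutelyContinuous_primitive g a).continuousOn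

theorem integral_primitive_mul_deriv (g : State) (a : ℝ) {ψ : ℝ → ℝ} (hψ : ContDiff ℝ 1 ψ) :
    ∫ x in (0 : ℝ)..1, (a + ∫ s in (0 : ℝ)..x, g s) * deriv ψ x
      = (a + ∫ s in (0 : ℝ)..1, g s) * ψ 1 - a * ψ 0 - ∫ x, g x * ψ x ∂μ := by
  rw [integral_eq_intervalIntegral,
    (absolutelyContinuous_primitive g a).integral_mul_deriv_eq_deriv_mul
      hψ.contDiffOn.absolutelyContinuousOnInterval]
  simp only [intervalIntegral.integral_same, add_zero]
  congr 1
  refine intervalIntegral.integral_congr_ae ?_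
  filter_upwards [(intervalIntegrable_state g).ae_hasDerivAt_integral] with x hx hx'
  rw [((hx (uIoc_subset_uIcc hx') 0 (by simp)).const_add a).deriv]

theorem IsTest.contDiff_one {ψ : ℝ → ℝ} (hψ : IsTest ψ) : ContDiff ℝ 1 ψ :=
  hψ.smooth.of_le (by simp)

theorem IsTest.continuousOn {ψ : ℝ → ℝ} (hψ : IsTest ψ) {s : Set ℝ} : ContinuousOn ψ s :=
  hψ.smooth.continuous.continuousOn

theorem IsTest.integrable {ψ : ℝ → ℝ} (hψ : IsTest ψ) : Integrable ψ μ :=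
  (memLp_of_continuousOn hψ.continuousOn).integrable one_le_two

theorem IsTest.eq_zero_of_notMem {ψ : ℝ → ℝ} (hψ : IsTest ψ) {x : ℝ} (hx : x ∉ Ioo (0 : ℝ) 1) :
    ψ x = 0 :=
  image_eq_zero_of_notMem_tsupport fun h => hx (hψ.supp h)

theorem hasWeakDeriv_primitive (g : State) (a : ℝ) :
    HasWeakDeriv (mk _ (continuousOn_primitive g a)) g := fun ψ hψ => by
  rw [integral_mk_mul, integral_primitive_mul_deriv g a hψ.contDiff_one,
    hψ.eq_zero_of_notMem (x := 0) (by simp), hψ.eq_zero_of_notMem (x := 1) (by simp)]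
  ring

theorem IsTest.exists_tsupport_subset_Icc {ψ : ℝ → ℝ} (hψ : IsTest ψ) :
    ∃ a b : ℝ, 0 < a ∧ b < 1 ∧ tsupport ψ ⊆ Icc a b := by
  rcases (tsupport ψ).eq_empty_or_nonempty with hempty | hne
  · exact ⟨1, 0, by simp [hempty]⟩
  · obtain ⟨a, ha⟩ := hψ.compact.isCompact.exists_isLeast hne
    obtain ⟨b, hb⟩ := hψ.compact.isCompact.exists_isGreatest hne
    exact ⟨a, b, (hψ.supp ha.1).1, (hψ.supp hb.1).2, fun x hx => ⟨ha.2 hx, hb.2 hx⟩⟩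

theorem support_primitive_subset_Icc {ψ : ℝ → ℝ} (hψ : Continuous ψ) {a b p q : ℝ}
    (ha : p < a) (hb : b ≤ q) (hsupp : Function.support ψ ⊆ Icc a b)
    (h0 : ∫ s in p..q, ψ s = 0) : Function.support (fun x => ∫ s in p..x, ψ s) ⊆ Icc a b := by
  refine fun x hx => ⟨not_lt.1 fun hxa => hx ?_, not_lt.1 fun hbx => hx ?_⟩
  · refine intervalIntegral.integral_zero_ae (Eventually.of_forall fun s hs => ?_)
    exact Function.notMem_support.1 fun hs' =>
      (hs.2.trans_lt (max_lt ha hxa)).not_ge (hsupp hs').1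
  · change ∫ s in p..x, ψ s = 0
    rw [← intervalIntegral.integral_add_adjacent_intervals (hψ.intervalIntegrable p q)
      (hψ.intervalIntegrable q x), h0, zero_add]
    refine intervalIntegral.integral_zero_ae (Eventually.of_forall fun s hs => ?_)
    exact Function.notMem_support.1 fun hs' =>
      ((le_min hb hbx.le).trans_lt hs.1).not_ge (hsupp hs').2

theorem IsTest.exists_deriv_eq {ψ : ℝ → ℝ} (hψ : IsTest ψ) (h0 : ∫ x, ψ x ∂μ = 0) :
    ∃ Ψ : ℝ → ℝ, IsTest Ψ ∧ deriv Ψ = ψ := by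
  obtain ⟨a, b, ha, hb, hab⟩ := hψ.exists_tsupport_subset_Icc
  have hderiv (x : ℝ) : HasDerivAt (fun x => ∫ s in (0 : ℝ)..x, ψ s) (ψ x) x :=
    (hψ.smooth.continuous.integral_hasStrictDerivAt 0 x).hasDerivAt
  have hderiv_eq := funext fun x => (hderiv x).deriv
  have hsupp : tsupport (fun x => ∫ s in (0 : ℝ)..x, ψ s) ⊆ Icc a b :=
    closure_minimal (support_primitive_subset_Icc hψ.smooth.continuous ha hb.le
      ((subset_tsupport ψ).trans hab) (integral_eq_intervalIntegral ψ ▸ h0)) isClosed_Icc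
  refine ⟨_, ⟨?_, isCompact_Icc.of_isClosed_subset (isClosed_tsupport _) hsupp,
    hsupp.trans (Icc_subset_Ioo ha hb)⟩, hderiv_eq⟩
  rw [contDiff_infty_iff_deriv, hderiv_eq]
  exact ⟨fun x => (hderiv x).differentiableAt, hψ.smooth⟩

theorem exists_isTest_integral_eq_one : ∃ η : ℝ → ℝ, IsTest η ∧ ∫ x, η x ∂μ = 1 := by
  let f : ContDiffBump (1 / 2 : ℝ) := ⟨1 / 8, 1 / 4, by norm_num, by norm_num⟩
  have hsupp : tsupport (f.normed volume) ⊆ Ioo 0 1 := by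
    rw [f.tsupport_normed_eq, Real.closedBall_eq_Icc]
    exact Icc_subset_Ioo (by norm_num [f]) (by norm_num [f])
  refine ⟨f.normed volume, ⟨f.contDiff_normed, f.hasCompactSupport_normed, hsupp⟩, ?_⟩
  refine Eq.trans ?_ (f.integral_normed (μ := volume))
  exact setIntegral_eq_integral_of_forall_compl_eq_zero fun x hx =>
    image_eq_zero_of_notMem_tsupport fun hx' => hx (hsupp hx')

theorem IsTest.sub_const_mul {ψ η : ℝ → ℝ} (hψ : IsTest ψ) (hη : IsTest η) (a : ℝ) :
    IsTest (ψ - fun x => a * η x) := by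
  have hsupp : tsupport (ψ - fun x => a * η x) ⊆ tsupport ψ ∪ tsupport η :=
    (tsupport_sub ψ _).trans
      (union_subset_union_right _ (tsupport_mul_subset_right (f := fun _ => a)))
  exact ⟨hψ.smooth.sub (contDiff_const.mul hη.smooth),
    (hψ.compact.isCompact.union hη.compact.isCompact).of_isClosed_subset (isClosed_tsupport _)
      hsupp, hsupp.trans (union_subset hψ.supp hη.supp)⟩

/-- The du Bois-Reymond lemma. Subtracting a multiple of a fixed test function of integral `1` makes
a test function the derivative of another one. -/
theorem HasWeakDeriv.exists_eq_const {f : State} (h : HasWeakDeriv f 0) :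
    ∃ a : ℝ, f = mk (fun _ => a) continuousOn_const := by
  obtain ⟨η, hη, hη1⟩ := exists_isTest_integral_eq_one
  have h_mean (ψ : ℝ → ℝ) (hψ : IsTest ψ) (h0 : ∫ x, ψ x ∂μ = 0) : ∫ x, f x * ψ x ∂μ = 0 := by
    obtain ⟨Ψ, hΨ, rfl⟩ := hψ.exists_deriv_eq h0
    rw [h Ψ hΨ, neg_eq_zero]
    refine integral_eq_zero_of_ae ?_
    filter_upwards [Lp.coeFn_zero ℝ 2 μ] with x hx
    rw [hx, Pi.zero_apply, zero_mul]
  set a : ℝ := ∫ x, f x * η x ∂μ with ha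
  refine ⟨a, sub_eq_zero.1 (eq_zero_of_test fun ψ hψ => ?_)⟩
  set m : ℝ := ∫ x, ψ x ∂μ with hm
  have hf : ∫ x, f x * ψ x ∂μ - m * a = 0 := by
    rw [ha, ← integral_const_mul, ← integral_sub (integrable_mul f hψ.continuousOn)
      ((integrable_mul f hη.continuousOn).const_mul m), ← h_mean _ (hψ.sub_const_mul hη m)]
    · refine integral_congr_ae (Eventually.of_forall fun x => ?_)
      simp only [Pi.sub_apply]
      ring
    · simp only [Pi.sub_apply]
      rw [integral_sub hψ.integrable (hη.integrable.const_mul m), integral_const_mul, hη1, ← hm]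
      ring
  rw [← inner_mk _ hψ.continuousOn, inner_sub_left, inner_mk, inner_mk, integral_mk_mul,
    intervalIntegral.integral_const_mul, ← integral_eq_intervalIntegral, ← hm, mul_comm, hf]

theorem HasWeakDeriv.exists_eq_primitive {f g : State} (h : HasWeakDeriv f g) :
    ∃ a : ℝ, f = mk _ (continuousOn_primitive g a) := by
  have h0 := h.add ((hasWeakDeriv_primitive g 0).smul (-1))
  rw [neg_one_smul, neg_one_smul, add_neg_cancel] at h0
  obtain ⟨a, ha⟩ := h0.exists_eq_const
  refine ⟨a, ?_⟩
  rw [← sub_eq_add_neg, sub_eq_iff_eq_add] at ha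
  rw [ha]
  refine Lp.ext (((isContRep_mk _).add (isContRep_mk _)).2.trans ?_)
  simpa using (isContRep_mk (continuousOn_primitive g a)).2.symm

theorem HasWeakDeriv.exists_isContRep_integral_mul_deriv {f g : State} (h : HasWeakDeriv f g) :
    ∃ v, IsContRep f v ∧ ∀ ψ : ℝ → ℝ, ContDiff ℝ 1 ψ →
      ∫ x, f x * deriv ψ x ∂μ = v 1 * ψ 1 - v 0 * ψ 0 - ∫ x, g x * ψ x ∂μ := by
  obtain ⟨a, rfl⟩ := h.exists_eq_primitive
  refine ⟨_, isContRep_mk _, fun ψ hψ => ?_⟩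
  rw [integral_mk_mul, integral_primitive_mul_deriv g a hψ]
  simp

/-- Green's formula. -/
theorem VanishesAtEnds.integral_weakDeriv_mul {y g h : State} (hy : VanishesAtEnds y)
    (hg : HasWeakDeriv y g) (hh : HasWeakDeriv g h) {ψ : ℝ → ℝ} (hψ : ContDiff ℝ 2 ψ)
    (h0 : ψ 0 = 0) (h1 : ψ 1 = 0) :
    ∫ x, h x * ψ x ∂μ = ∫ x, y x * deriv (deriv ψ) x ∂μ := by
  obtain ⟨v, hv, hv0, hv1⟩ := hy
  obtain ⟨w, hw, hw_parts⟩ := hg.exists_isContRep_integral_mul_deriv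
  obtain ⟨z, -, hz_parts⟩ := hh.exists_isContRep_integral_mul_deriv
  have hw0 : w 0 = 0 := (hv.eqOn hw (left_mem_Icc.2 zero_le_one)).symm.trans hv0
  have hw1 : w 1 = 0 := (hv.eqOn hw (right_mem_Icc.2 zero_le_one)).symm.trans hv1
  have hψ' : ContDiff ℝ 1 (deriv ψ) :=
    ((contDiff_succ_iff_deriv (n := 1)).1 (by simpa [one_add_one_eq_two] using hψ)).2.2
  rw [hw_parts _ hψ', hz_parts _ (hψ.of_le one_le_two), hw0, hw1, h0, h1]
  ring

/-! ### Dirichlet eigenfunctions -/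

/-- The Dirichlet eigenfunction `√2 sin((n + 1) π x)`. The index is shifted so that `n` ranges over
all of `ℕ`. -/
def sine (n : ℕ) (x : ℝ) : ℝ := √2 * Real.sin ((n + 1) * Real.pi * x)

/-- The eigenvalue of `heatOp c` for the eigenfunction `sine n`. -/
def eigenvalue (c : ℝ) (n : ℕ) : ℝ := c - ((n + 1) * Real.pi) ^ 2

theorem contDiff_sine (n : ℕ) {k : ℕ∞ω} : ContDiff ℝ k (sine n) := by
  unfold sine
  fun_prop

theorem continuousOn_sine (n : ℕ) {s : Set ℝ} : ContinuousOn (sine n) s :=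
  (contDiff_sine n (k := 0)).continuous.continuousOn

theorem sine_zero (n : ℕ) : sine n 0 = 0 := by simp [sine]

theorem sine_eq_zero_iff {n : ℕ} {x : ℝ} : sine n x = 0 ↔ ∃ k : ℤ, x = k / (n + 1) := by
  have hpi := Real.pi_pos
  rw [sine, mul_eq_zero_iff_left (by positivity), Real.sin_eq_zero_iff]
  refine exists_congr fun k => ?_
  rw [eq_div_iff (by positivity), mul_right_comm, mul_left_inj' hpi.ne', mul_comm x, eq_comm]

theorem sine_one (n : ℕ) : sine n 1 = 0 :=
  sine_eq_zero_iff.2 ⟨n + 1, by push_cast; field_simp⟩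

theorem forall_sine_ne_zero_iff_irrational {x : ℝ} : (∀ n, sine n x ≠ 0) ↔ Irrational x := by
  simp only [ne_eq, sine_eq_zero_iff, not_exists]
  refine ⟨?_, fun hx n k hk => hx ⟨k / (n + 1 : ℕ), by push_cast [hk]; rfl⟩⟩
  rintro h ⟨q, rfl⟩
  refine h (q.den - 1) q.num ?_
  rw [← Nat.cast_add_one, Nat.sub_add_cancel q.pos]
  exact Rat.cast_def q

theorem hasDerivAt_sine (n : ℕ) (x : ℝ) :
    HasDerivAt (sine n) (√2 * (((n + 1) * Real.pi) * Real.cos ((n + 1) * Real.pi * x))) x := by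
  have h := (hasDerivAt_id x).const_mul ((n + 1) * Real.pi)
  exact (h.sin.const_mul √2).congr_deriv (by simp only [id]; ring)

theorem hasDerivAt_deriv_sine (n : ℕ) (x : ℝ) :
    HasDerivAt (fun x => √2 * (((n + 1) * Real.pi) * Real.cos ((n + 1) * Real.pi * x)))
      (-((n + 1) * Real.pi) ^ 2 * sine n x) x := by
  have h := (hasDerivAt_id x).const_mul ((n + 1) * Real.pi)
  exact ((h.cos.const_mul _).const_mul √2).congr_deriv (by simp only [id, sine]; ring)

theorem deriv_deriv_sine (n : ℕ) :
    deriv (deriv (sine n)) = fun x => -((n + 1) * Real.pi) ^ 2 * sine n x := by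
  rw [funext fun x => (hasDerivAt_sine n x).deriv]
  exact funext fun x => (hasDerivAt_deriv_sine n x).deriv

/-- The Dirichlet eigenfunction `sine n` as an element of `L²(0, 1)`. -/
def mode (n : ℕ) : State := mk (sine n) (continuousOn_sine n)

theorem inner_mode (n : ℕ) (f : State) : ⟪mode n, f⟫_ℝ = ∫ x, f x * sine n x ∂μ := by
  rw [real_inner_comm, mode, inner_mk]

theorem mode_mem_graph (c : ℝ) (n : ℕ) : (mode n, eigenvalue c n • mode n) ∈ (heatOp c).graph := by
  have hcont : ContinuousOn (fun x => -((n + 1) * Real.pi) ^ 2 * sine n x) (Icc 0 1) :=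
    continuousOn_const.mul (continuousOn_sine n)
  have hmk : mk _ hcont = (-((n + 1) * Real.pi) ^ 2) • mode n :=
    Lp.ext ((isContRep_mk hcont).2.trans ((isContRep_mk (continuousOn_sine n)).smul _).2.symm)
  rw [eigenvalue, sub_eq_neg_add, add_smul, ← hmk]
  exact mem_heatOp_graph (continuousOn_sine n) (by fun_prop) hcont (hasDerivAt_sine n)
    (hasDerivAt_deriv_sine n) (sine_zero n) (sine_one n) c

theorem inner_mode_of_mem_graph {c : ℝ} {p : State × State} (hp : p ∈ (heatOp c).graph) (n : ℕ) :
    ⟪mode n, p.2⟫_ℝ = eigenvalue c n * ⟪mode n, p.1⟫_ℝ := by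
  rw [heatOp_graph] at hp
  obtain ⟨hy, g, h, hg, hh, hp2⟩ := hp
  have hgreen : ⟪mode n, h⟫_ℝ = -((n + 1) * Real.pi) ^ 2 * ⟪mode n, p.1⟫_ℝ := by
    rw [inner_mode, hy.integral_weakDeriv_mul hg hh (contDiff_sine n) (sine_zero n) (sine_one n),
      deriv_deriv_sine, inner_mode, ← integral_const_mul]
    simp only [mul_left_comm]
  rw [hp2, inner_add_right, real_inner_smul_right, hgreen, eigenvalue]
  ring

theorem eigenvalue_strictAnti (c : ℝ) : StrictAnti (eigenvalue c) := by
  intro m n hmn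
  have := Real.pi_pos
  unfold eigenvalue
  gcongr

theorem tendsto_eigenvalue (c : ℝ) : Tendsto (eigenvalue c) cofinite atBot := by
  rw [Nat.cofinite_eq_atTop]
  refine tendsto_atBot_add_const_left _ c (tendsto_neg_atTop_atBot.comp ?_)
  exact (tendsto_pow_atTop two_ne_zero).comp
    ((tendsto_natCast_atTop_atTop.atTop_add tendsto_const_nhds).atTop_mul_const Real.pi_pos)

theorem inner_mode_self (n : ℕ) : ⟪mode n, mode n⟫_ℝ = 1 := by
  have hk : ((n : ℝ) + 1) * Real.pi ≠ 0 := by have := Real.pi_pos; positivity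
  have hsin : Real.sin ((n + 1) * Real.pi) = 0 := by simpa using Real.sin_nat_mul_pi (n + 1)
  have hsq (x : ℝ) : sine n x * sine n x = 2 * Real.sin ((n + 1) * Real.pi * x) ^ 2 := by
    rw [sine, mul_mul_mul_comm, Real.mul_self_sqrt zero_le_two, sq]
  rw [inner_mode, mode, integral_mk_mul]
  simp only [hsq]
  rw [intervalIntegral.integral_const_mul,
    intervalIntegral.integral_comp_mul_left (fun x => Real.sin x ^ 2) hk, integral_sin_sq]
  simp [hsin]
  field_simp

theorem orthonormal_mode : Orthonormal ℝ mode := by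
  rw [orthonormal_iff_ite]
  intro m n
  split_ifs with hmn
  · rw [hmn, inner_mode_self]
  · have heig := inner_mode_of_mem_graph (mode_mem_graph 0 n) m
    rw [real_inner_smul_right] at heig
    exact (mul_eq_mul_right_iff.1 heig).resolve_left
      fun h => hmn ((eigenvalue_strictAnti 0).injective h).symm

theorem integral_mul_cos_pow_mul_sin {f : State} (hf : ∀ n, ⟪mode n, f⟫_ℝ = 0) (k n : ℕ) :
    ∫ x, f x * (Real.cos (Real.pi * x) ^ k * Real.sin (n * (Real.pi * x))) ∂μ = 0 := by
  induction k generalizing n with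
  | zero =>
    obtain _ | n := n
    · simp
    · have hn := hf n
      simp only [inner_mode, sine, mul_left_comm _ √2, integral_const_mul] at hn
      simpa [mul_assoc] using hn
  | succ k ih =>
    obtain _ | n := n
    · simp
    · have hint (m : ℕ) : Integrable
          (fun x => f x * (Real.cos (Real.pi * x) ^ k * Real.sin (m * (Real.pi * x)))) μ :=
        integrable_mul f (by fun_prop)
      have hrec (x : ℝ) :
          f x * (Real.cos (Real.pi * x) ^ (k + 1) * Real.sin ((n + 1 : ℕ) * (Real.pi * x)))
            = 2⁻¹ * (f x * (Real.cos (Real.pi * x) ^ k * Real.sin ((n + 2 : ℕ) * (Real.pi * x)))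
              + f x * (Real.cos (Real.pi * x) ^ k * Real.sin (n * (Real.pi * x)))) := by
        have hadd : ((n + 2 : ℕ) : ℝ) * (Real.pi * x)
            = ((n + 1 : ℕ) : ℝ) * (Real.pi * x) + Real.pi * x := by push_cast; ring
        have hsub : (n : ℝ) * (Real.pi * x)
            = ((n + 1 : ℕ) : ℝ) * (Real.pi * x) - Real.pi * x := by push_cast; ring
        rw [hadd, hsub, Real.sin_add, Real.sin_sub]
        ring
      simp only [hrec]
      rw [integral_const_mul, integral_add (hint _) (hint _), ih, ih, add_zero, mul_zero]

theorem integral_mul_polynomial_cos_mul_sin {f : State} (hf : ∀ n, ⟪mode n, f⟫_ℝ = 0)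
    (p : Polynomial ℝ) :
    ∫ x, f x * (p.eval (Real.cos (Real.pi * x)) * Real.sin (Real.pi * x)) ∂μ = 0 := by
  have hsum (x : ℝ) : f x * (p.eval (Real.cos (Real.pi * x)) * Real.sin (Real.pi * x))
      = ∑ k ∈ p.support, p.coeff k *
        (f x * (Real.cos (Real.pi * x) ^ k * Real.sin ((1 : ℕ) * (Real.pi * x)))) := by
    rw [Polynomial.eval_eq_sum, Polynomial.sum, Finset.sum_mul, Finset.mul_sum]
    refine Finset.sum_congr rfl fun k _ => ?_
    rw [Nat.cast_one, one_mul]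
    ring
  simp only [hsum]
  rw [integral_finsetSum _ fun k _ => (integrable_mul f (by fun_prop)).const_mul _]
  refine Finset.sum_eq_zero fun k _ => ?_
  rw [integral_const_mul, integral_mul_cos_pow_mul_sin hf, mul_zero]

theorem IsTest.continuous_div_sin {ψ : ℝ → ℝ} (hψ : IsTest ψ) :
    Continuous fun x => ψ x / Real.sin (Real.pi * x) := by
  refine continuous_iff_continuousAt.2 fun x => ?_
  by_cases hx : x ∈ tsupport ψ
  · have hpi := Real.pi_pos
    have hsin : 0 < Real.sin (Real.pi * x) :=
      Real.sin_pos_of_pos_of_lt_pi (mul_pos hpi (hψ.supp hx).1)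
        (mul_lt_of_lt_one_right hpi (hψ.supp hx).2)
    exact hψ.smooth.continuous.continuousAt.div (by fun_prop) hsin.ne'
  · refine (continuousAt_const (y := (0 : ℝ))).congr ?_
    filter_upwards [notMem_tsupport_iff_eventuallyEq.1 hx] with y hy
    simp [hy]

/-- Weierstrass approximation of `ψ(x) / sin(π x)` as a function of `cos(π x)`. -/
theorem IsTest.exists_polynomial_near {ψ : ℝ → ℝ} (hψ : IsTest ψ) {ε : ℝ} (hε : 0 < ε) :
    ∃ p : Polynomial ℝ, ∀ x ∈ Ioo (0 : ℝ) 1,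
      |ψ x - p.eval (Real.cos (Real.pi * x)) * Real.sin (Real.pi * x)| ≤ ε := by
  have hpi := Real.pi_pos
  have hcont : Continuous fun t => ψ (Real.arccos t / Real.pi) /
      Real.sin (Real.pi * (Real.arccos t / Real.pi)) :=
    hψ.continuous_div_sin.comp (Real.continuous_arccos.div_const _)
  obtain ⟨p, hp⟩ := exists_polynomial_near_of_continuousOn (-1) 1 _ hcont.continuousOn ε hε
  refine ⟨p, fun x hx => ?_⟩
  have hx0 : 0 < Real.pi * x := mul_pos hpi hx.1
  have hx1 : Real.pi * x < Real.pi := mul_lt_of_lt_one_right hpi hx.2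
  have hsin := Real.sin_pos_of_pos_of_lt_pi hx0 hx1
  have hpx := hp (Real.cos (Real.pi * x)) ⟨Real.neg_one_le_cos _, Real.cos_le_one _⟩
  rw [Real.arccos_cos hx0.le hx1.le, mul_div_cancel_left₀ _ hpi.ne'] at hpx
  calc |ψ x - p.eval (Real.cos (Real.pi * x)) * Real.sin (Real.pi * x)|
      = |p.eval (Real.cos (Real.pi * x)) - ψ x / Real.sin (Real.pi * x)|
        * |Real.sin (Real.pi * x)| := by
        rw [← abs_mul, sub_mul, div_mul_cancel₀ _ hsin.ne', abs_sub_comm]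
    _ ≤ ε := (mul_le_of_le_one_right (abs_nonneg _) (Real.abs_sin_le_one _)).trans hpx.le

theorem eq_zero_of_inner_mode {f : State} (hf : ∀ n, ⟪mode n, f⟫_ℝ = 0) : f = 0 := by
  refine eq_zero_of_test fun ψ hψ => ?_
  have hfint : Integrable f μ := (Lp.memLp f).integrable one_le_two
  have hbound (ε : ℝ) (hε : 0 < ε) : |∫ x, f x * ψ x ∂μ| ≤ (∫ x, |f x| ∂μ) * ε := by
    obtain ⟨p, hp⟩ := hψ.exists_polynomial_near hε
    have hsub : ∫ x, f x * ψ x ∂μ = ∫ x, f x *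
        (ψ x - p.eval (Real.cos (Real.pi * x)) * Real.sin (Real.pi * x)) ∂μ := by
      simp only [mul_sub]
      rw [integral_sub (integrable_mul f hψ.continuousOn) (integrable_mul f (by fun_prop)),
        integral_mul_polynomial_cos_mul_sin hf, sub_zero]
    rw [hsub, ← integral_mul_const, ← Real.norm_eq_abs]
    refine norm_integral_le_of_norm_le (hfint.abs.mul_const ε) ?_
    filter_upwards [ae_restrict_mem measurableSet_Ioo] with x hx
    rw [norm_mul]
    exact mul_le_mul_of_nonneg_left (hp x hx) (abs_nonneg _)
  have hlim : Tendsto (fun ε : ℝ => (∫ x, |f x| ∂μ) * ε) (𝓝[>] 0) (𝓝 0) := by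
    have h0 : Tendsto id (𝓝[>] (0 : ℝ)) (𝓝 0) := tendsto_id.mono_left nhdsWithin_le_nhds
    simpa using h0.const_mul (∫ x, |f x| ∂μ)
  exact abs_nonpos_iff.1 (ge_of_tendsto hlim (eventually_mem_nhdsWithin.mono hbound))

/-- The Dirichlet eigenfunctions as a Hilbert basis of `L²(0, 1)`. -/
def modeBasis : HilbertBasis ℕ ℝ State :=
  HilbertBasis.mkOfOrthogonalEqBot orthonormal_mode <| (Submodule.eq_bot_iff _).2 fun _ hf =>
    eq_zero_of_inner_mode fun n =>
      Submodule.inner_right_of_mem_orthogonal (Submodule.subset_span (mem_range_self n)) hf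

theorem modeBasis_apply (n : ℕ) : modeBasis n = mode n := by
  simp [modeBasis]

theorem isEigenbasis_heatOp (c : ℝ) : IsEigenbasis (heatOp c) modeBasis (eigenvalue c) where
  mem_graph n := by simpa only [modeBasis_apply] using mode_mem_graph c n
  inner_snd _ hp n := by simpa only [modeBasis_apply] using inner_mode_of_mem_graph hp n

theorem pointControl_one_adjointMode (c : ℝ) (x₀ : Ioo (0 : ℝ) 1) (n : ℕ) :
    pointControl c x₀ 1 ((isEigenbasis_heatOp c).adjointMode n) = sine n x₀ := by
  have hrep : IsContRep (modeBasis n) (sine n) :=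
    modeBasis_apply n ▸ isContRep_mk (continuousOn_sine n)
  rw [pointControl, ContinuousLinearMap.toSpanSingleton_apply, one_smul]
  exact (exists_contRep ((isEigenbasis_heatOp c).adjointMode n).2).choose_spec.1.eqOn hrep
    (Ioo_subset_Icc_self x₀.2)

end PointHeat

end

theorem theorem4p5_general (c x₀ : ℝ) (hx₀ : x₀ ∈ Set.Ioo (0 : ℝ) 1) :
    CompletelyStabilizable (PointHeat.heatOp c) (PointHeat.pointControl c ⟨x₀, hx₀⟩) ↔
      Irrational x₀ := by
  rw [(PointHeat.isEigenbasis_heatOp c).completelyStabilizable_iff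
    (PointHeat.eigenvalue_strictAnti c).injective (PointHeat.tendsto_eigenvalue c)]
  simp only [PointHeat.pointControl_one_adjointMode]
  exact PointHeat.forall_sine_ne_zero_iff_irrational

theorem theorem4p5 (c : ℝ) (hc : Real.pi ^ 2 < c) (x₀ : ℝ) (hx₀ : x₀ ∈ Set.Ioo (0 : ℝ) 1) :
    CompletelyStabilizable (PointHeat.heatOp c) (PointHeat.pointControl c ⟨x₀, hx₀⟩) ↔
      Irrational x₀ :=
  theorem4p5_general c x₀ hx₀
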